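/- Let $f=\frac1m\sum_{i=1}^m f_i:\mathbb R^n\to(-\infty,+\infty]$ ($m\ge1$) be $\sigma$-strongly convex, $\sigma>0$, with minimizer $x^*$, and write $\mathbb B(x^*,r)$ for the open Euclidean ball. Let $\hat\epsilon_0>0$ be such that on $\mathbb B(x^*,\hat\epsilon_0)$ all $f_i$ are finite and twice differentiable, $f$ is twice continuously differentiable, $\nabla f$ is $L_g$-Lipschitz, $\nabla^2 f$ is $L_h$-Lipschitz, $\|\nabla f\|\le U_g$, and $\|\nabla f_i\|\le\widehat U_g$, $\|\nabla^2 f_i\|\le\widehat U_h$ for all $i$, where $U_g,\widehat U_g,\widehat U_h\in(0,\infty)$ and matrix norms are spectral. Let $\theta\in(0,1]$, $\bar\delta^g\in[0,1)$, $\bar\delta^h\in(0,\sigma)$, $\bar\delta\in(0,1)$, and put $$\varsigma_0=\frac{2(L_h\hat\epsilon_0+2L_g)}{\sigma-\bar\delta^h},\qquad \hat\epsilon_1=\frac{\hat\epsilon_0}{1+\varsigma_0},\qquad a=L_g+\sigma+\frac{U_g^\theta}{2(1-\bar\delta^g)^\theta},\qquad \varsigma_1=\frac{(a+\sigma+\frac12)\,a^\theta}{1-\bar\delta^g},$$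 $$\varsigma_2=\frac{1+\bar\delta^g}{\sigma}\Big(\frac{L_h\varsigma_0^2\hat\epsilon_1^{1-\theta}}{2(1-\bar\delta^g)}+\varsigma_1\varsigma_0^{1+\theta}\Big),\qquad \hat\epsilon_2=\min\{\hat\epsilon_1,(2\varsigma_2)^{-1/\theta}\},\qquad \hat\epsilon_3\in\Big(0,\frac{\hat\epsilon_2}{1+2\varsigma_0}\Big].$$ Consider the following method, started at $x_0\in\mathbb B(x^*,\hat\epsilon_3)$. In iteration $k=0,1,\dots$ a batch $\mathcal S_{g,k}$ of indices from $\{1,\dots,m\}$ is drawn uniformly at random, with or without replacement, independently of the past except that its size may depend on the past; then a batch $\mathcal S_{h,k}$ is drawn in the same way, where the past now includes $\mathcal S_{g,k}$. Set $$g_k=\frac1{|\mathcal S_{g,k}|}\sum_{i\in\mathcal S_{g,k}}\nabla f_i(x_k),\qquad Q_k=\frac1{|\mathcal S_{h,k}|}\sum_{i\in\mathcal S_{h,k}}\nabla^2 f_i(x_k).$$ If $g_k\ne0$, then the accuracy parameters satisfy $\delta_k^h\in(0,\min\{\bar\delta^h,\|g_k\|^\theta\}]$ and $\delta_k^g\in[0,\min\{\bar\delta^g,\|g_k\|^\theta,\frac{\sigma-\delta_k^h}{2(L_g+\delta_k^h)}\}]$,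 and $x_{k+1}=x_k+d_k$ with any $d_k$ such that $$\|Q_kd_k+g_k\|\le\frac{\mu_k}2\|g_k\|^\theta\|d_k\|,\qquad \mu_k=\min\Big\{1,\frac{\sigma-\delta_k^h}{4\|g_k\|^\theta}\Big\}.$$ Say that the batches of iteration $k$ are large enough if $g_k\neq0$, $\delta^g_k>0$, $$|\mathcal S_{g,k}|\ge\frac{\widehat U_g^2\big(1+\sqrt{8\ln(1/\bar\delta)}\big)^2}{(\delta_k^g)^2\|g_k\|^2}\qquad\text{and}\qquad |\mathcal S_{h,k}|\ge\frac{16\,\widehat U_h^2}{(\delta_k^h)^2}\ln\frac{2n}{\bar\delta}.$$ Then for every $k\ge0$, with probability at least $(1-\bar\delta)^k$ the following holds: if the batches of the first $k$ iterations $j=0,\dots,k-1$ are all large enough, then $$\|x_{j+1}-x^*\|\le\varsigma_2\|x_j-x^*\|^{1+\theta}\qquad\text{for all } j=0,\dots,k-1.$$ In particular, if the batches are almost surely large enough in the first $k$ iterations, then these estimates hold with probability at least $(1-\bar\delta)^k$. -/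

import Mathlib

open MeasureTheory

noncomputable section

namespace OEFNewton

/-- `ℝⁿ` with the Euclidean norm. -/
abbrev Vec (n : ℕ) : Type := EuclideanSpace ℝ (Fin n)

/-! ### Finite-sum objective and subsampled derivatives -/

/-- The finite-sum objective `f = (1/m) ∑ᵢ fᵢ`. -/
def finiteSum {n m : ℕ} (F : Fin m → Vec n → ℝ) (x : Vec n) : ℝ :=
  (1 / (m : ℝ)) * ∑ i, F i x

/-- The Hessian of `f` at `x`, as a linear operator on `ℝⁿ` (its norm is the spectral norm). -/
def hessian {n : ℕ} (f : Vec n → ℝ) (x : Vec n) : Vec n →L[ℝ] Vec n :=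
  fderiv ℝ (gradient f) x

/-- The subsampled gradient `(1/|S|) ∑_{i ∈ S} ∇fᵢ(x)`. A batch is the list of the drawn indices,
and its size `|S|` is the number of draws. -/
def subGradient {n m : ℕ} (F : Fin m → Vec n → ℝ) (S : List (Fin m)) (x : Vec n) : Vec n :=
  (1 / (S.length : ℝ)) • (S.map fun i => gradient (F i) x).sum

/-- The subsampled Hessian `(1/|S|) ∑_{i ∈ S} ∇²fᵢ(x)`. -/
def subHessian {n m : ℕ} (F : Fin m → Vec n → ℝ) (S : List (Fin m)) (x : Vec n) :
    Vec n →L[ℝ] Vec n :=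
  (1 / (S.length : ℝ)) • (S.map fun i => hessian (F i) x).sum

/-! ### Uniform sampling of batches -/

/-- The two standard ways of drawing a batch of indices uniformly at random. -/
inductive Sampling
  | withReplacement
  | withoutReplacement

/-- The index lists that the sampling scheme can draw. -/
def Sampling.Admissible (c : Sampling) {m : ℕ} (l : List (Fin m)) : Prop :=
  match c with
  | .withReplacement => True
  | .withoutReplacement => l.Nodup

/-- The number of admissible lists of `s` indices out of `m`. -/
def Sampling.count (c : Sampling) (m s : ℕ) : ℕ :=
  match c with
  | .withReplacement => m ^ s
  | .withoutReplacement => m.descFactorial s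

/-- Given the information `𝒜`, the random batch `S` has a known size and is uniformly distributed
on the admissible index lists of that size. -/
structure IsUniformBatch {Ω : Type*} [MeasurableSpace Ω] (P : MeasureTheory.Measure Ω)
    (c : Sampling) {m : ℕ} (𝒜 : MeasurableSpace Ω) (S : Ω → List (Fin m)) : Prop where
  size_known : ∀ s : ℕ, MeasurableSet[𝒜] {ω | (S ω).length = s}
  admissible : ∀ ω, c.Admissible (S ω)
  uniform : ∀ A : Set Ω, MeasurableSet[𝒜] A → ∀ l : List (Fin m), c.Admissible l →
    P (A ∩ {ω | S ω = l}) * (c.count m l.length : ENNReal)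
      = P (A ∩ {ω | (S ω).length = l.length})

/-! ### One iteration of the method -/

/-- `μ = min {1, (σ - δʰ) / (4 ‖g‖^θ)}`. -/
def mu {n : ℕ} (σ θ δh : ℝ) (g : Vec n) : ℝ :=
  min 1 ((σ - δh) / (4 * ‖g‖ ^ θ))

/-- The accuracy parameters `δᵍ`, `δʰ` lie in their prescribed ranges, and the step `d` solves
`Q d = -g` up to a residual of norm at most `(μ/2) ‖g‖^θ ‖d‖`. -/
structure IsNewtonStep {n : ℕ} (σ Lg θ δgBar δhBar δg δh : ℝ) (g d : Vec n)
    (Q : Vec n →L[ℝ] Vec n) : Prop where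
  grad_tol_nonneg : 0 ≤ δg
  grad_tol_le : δg ≤ min δgBar (min (‖g‖ ^ θ) ((σ - δh) / (2 * (Lg + δh))))
  hess_tol_pos : 0 < δh
  hess_tol_le : δh ≤ min δhBar (‖g‖ ^ θ)
  residual : ‖Q d + g‖ ≤ mu σ θ δh g / 2 * ‖g‖ ^ θ * ‖d‖

/-- The lower bounds on the sizes `Ng`, `Nh` of the gradient and the Hessian batch; `Ug` and `Uh`
bound the component gradients and Hessians. The bound on `Ng` presupposes `δᵍ ‖g‖ ≠ 0`. -/
structure SizesSuffice {n : ℕ} (Ug Uh δBar δg δh : ℝ) (g : Vec n) (Ng Nh : ℕ) : Prop where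
  grad_ne_zero : g ≠ 0
  grad_tol_pos : 0 < δg
  grad_size :
    Ug ^ 2 * (1 + √(8 * Real.log (1 / δBar))) ^ 2 / (δg ^ 2 * ‖g‖ ^ 2) ≤ (Ng : ℝ)
  hess_size : 16 * Uh ^ 2 / δh ^ 2 * Real.log (2 * (n : ℝ) / δBar) ≤ (Nh : ℝ)

/-! ### The constants -/

/-- `ς₀ = 2 (L_h ε₀ + 2 L_g) / (σ - δ̄ʰ)`. -/
def varsigma0 (σ Lg Lh ε0 δhBar : ℝ) : ℝ :=
  2 * (Lh * ε0 + 2 * Lg) / (σ - δhBar)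

/-- `ε₁ = ε₀ / (1 + ς₀)`. -/
def eps1 (σ Lg Lh ε0 δhBar : ℝ) : ℝ :=
  ε0 / (1 + varsigma0 σ Lg Lh ε0 δhBar)

/-- `ς₁ = (1/(1 - δ̄ᵍ)) (a + σ + 1/2) a^θ` with `a = L_g + σ + U_g^θ / (2 (1 - δ̄ᵍ)^θ)`. -/
def varsigma1 (σ Lg Ug θ δgBar : ℝ) : ℝ :=
  1 / (1 - δgBar) *
    ((Lg + σ + Ug ^ θ / (2 * (1 - δgBar) ^ θ)) + σ + 1 / 2) *
    (Lg + σ + Ug ^ θ / (2 * (1 - δgBar) ^ θ)) ^ θ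

/-- `ς₂ = ((1 + δ̄ᵍ)/σ) (L_h ς₀² ε₁^(1-θ) / (2 (1 - δ̄ᵍ)) + ς₁ ς₀^(1+θ))`. -/
def varsigma2 (σ Lg Lh Ug ε0 θ δgBar δhBar : ℝ) : ℝ :=
  (1 + δgBar) / σ *
    (Lh * varsigma0 σ Lg Lh ε0 δhBar ^ 2 * eps1 σ Lg Lh ε0 δhBar ^ (1 - θ) / (2 * (1 - δgBar))
      + varsigma1 σ Lg Ug θ δgBar * varsigma0 σ Lg Lh ε0 δhBar ^ (1 + θ))

/-- `ε₂ = min {ε₁, (2 ς₂)^(-1/θ)}`. -/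
def eps2 (σ Lg Lh Ug ε0 θ δgBar δhBar : ℝ) : ℝ :=
  min (eps1 σ Lg Lh ε0 δhBar) ((2 * varsigma2 σ Lg Lh Ug ε0 θ δgBar δhBar) ^ (-1 / θ))

end OEFNewton

end

/-! ### Sampling without replacement is dominated by sampling with replacement -/

/-! A deterministic estimate for one step is combined with tail bounds for uniform batches, through
bad events that do not mention the tolerances.

One step (`newton_step_le`): suppose `‖g - ∇f(x)‖ ≤ δᵍ ‖g‖` and `‖Q - ∇²f(x)‖ ≤ δʰ`. Strong
convexity bounds `Q` below by `σ - δʰ`, so `‖d‖` and `‖g‖` are comparable and both are `O(‖x -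
x*‖)`. The gradient at `x + d` is a Taylor remainder plus the Hessian error, the residual and the
gradient error. All are `O(‖x - x*‖^(1+θ))`, because both tolerances are at most `‖g‖^θ`; strong
monotonicity of `∇f` converts this into a bound on the new distance. For `‖x - x*‖ ≤ ε₂` the
distance at least halves, so the iterates never leave the ball.

Tail bounds: fix the point and the batch size. Hoeffding's comparison
(`card_pow_mul_sum_injective_le`) reduces convex functionals of a batch to draws with replacement.
For gradients, a Hilbert space bound on `cosh ‖·‖` (`sum_cosh_mul_norm_sum_le`) or the variance is
used; for Hessians, trace moments (`sum_traceCLM_pow_le`), which give a matrix Hoeffding inequality.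
By Markov's inequality the failure probabilities are at most `gradFail δ̄` and `δ̄² / 2`, and the
product of their complements is at least `1 - δ̄`.

Joining them: the required gradient batch size involves `g_k`, hence the batch itself, so it cannot
be conditioned on. A bad event instead compares the centred batch sum with a constant times `√|S|`,
and `|S|` is known before the draw. Its conditional probability is bounded for every size
(`measure_inter_bad_batch_le`), and an induction along the filtration gives `(1 - δ̄)^k`
(`le_measure_all_good`). That the batches are large enough is used only afterwards, outcome by
outcome. -/

theorem sum_fin_succ_fun {α M : Type*} [Fintype α] [AddCommMonoid M] {s : ℕ}
    (G : (Fin (s + 1) → α) → M) :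
    ∑ f, G f = ∑ a, ∑ f : Fin s → α, G (Fin.cons a f) := by
  rw [← Fintype.sum_prod_type']
  exact (Fintype.sum_equiv (Fin.consEquiv fun _ => α) _ _ fun _ => rfl).symm

/-- The sum of a midpoint convex function over permutations does not decrease when an index is
replaced by a possibly repeated one. -/
theorem sum_perm_le_sum_perm_repeat {ι V : Type*} [Fintype ι] [DecidableEq ι] [AddCommGroup V]
    {φ : V → ℝ} (hφ : ∀ x d, 2 * φ x ≤ φ (x + d) + φ (x - d)) (v : ι → V) {s : ℕ}
    (g : Fin s → ι) (hg : Function.Injective g) (b : ι) (hb : b ∉ Set.range g) (a : ι) (x : V) :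
    ∑ π : Equiv.Perm ι, φ (x + (v (π b) + ∑ i, v (π (g i)))) ≤
      ∑ π : Equiv.Perm ι, φ (x + v (π a) + ∑ i, v (π (g i))) := by
  have reidx : ∑ π : Equiv.Perm ι, φ (x + v (π a) + ∑ i, v (π (g i))) =
      ∑ π : Equiv.Perm ι, φ (x + v (π b) + ∑ i, v (π (Equiv.swap a b (g i)))) := by
    rw [← Equiv.sum_comp (Equiv.mulRight (Equiv.swap a b))]
    simp
  by_cases ha : a ∈ Set.range g
  · obtain ⟨j, rfl⟩ := ha
    have key : ∀ π : Equiv.Perm ι, ∑ i, v (π (Equiv.swap (g j) b (g i))) =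
        ∑ i, v (π (g i)) - v (π (g j)) + v (π b) := by
      intro π
      have : ∑ i, (v (π (Equiv.swap (g j) b (g i))) - v (π (g i))) =
          v (π b) - v (π (g j)) := by
        rw [Finset.sum_eq_single j]
        · simp
        · intro i _ hi
          rw [Equiv.swap_apply_of_ne_of_ne (fun h => hi (hg h)) (fun h => hb ⟨i, h⟩), sub_self]
        · simp
      rw [Finset.sum_sub_distrib] at this
      rw [sub_eq_iff_eq_add.mp this]
      abel
    -- If `a = g j`, the original argument is the midpoint of the one with `v (π a)` doubled and the
    -- one with `v (π b)` doubled. Exchanging `a` and `b` in `π` shows that these two have the same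
    -- sum over `π`.
    have h2 : ∑ π : Equiv.Perm ι, 2 * φ (x + (v (π b) + ∑ i, v (π (g i)))) ≤
        ∑ π : Equiv.Perm ι, (φ (x + v (π (g j)) + ∑ i, v (π (g i))) +
          φ (x + v (π b) + ∑ i, v (π (Equiv.swap (g j) b (g i))))) := by
      refine Finset.sum_le_sum fun π _ => ?_
      have := hφ (x + (v (π b) + ∑ i, v (π (g i)))) (v (π (g j)) - v (π b))
      rw [key]
      have e1 : x + (v (π b) + ∑ i, v (π (g i))) + (v (π (g j)) - v (π b)) =
          x + v (π (g j)) + ∑ i, v (π (g i)) := by abel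
      have e2 : x + (v (π b) + ∑ i, v (π (g i))) - (v (π (g j)) - v (π b)) =
          x + v (π b) + (∑ i, v (π (g i)) - v (π (g j)) + v (π b)) := by abel
      rwa [e1, e2] at this
    rw [← Finset.mul_sum, Finset.sum_add_distrib, ← reidx] at h2
    linarith
  · rw [reidx]
    refine le_of_eq (Finset.sum_congr rfl fun π _ => ?_)
    rw [add_assoc]
    congr 4
    funext i
    rw [Equiv.swap_apply_of_ne_of_ne (fun h => ha ⟨i, h⟩) (fun h => hb ⟨i, h⟩)]

/-- The draws of a random permutation are replaced one at a time by independent uniform draws;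
averaging `sum_perm_le_sum_perm_repeat` over the new index `a` handles one of them. The offset `x`
carries the draws already replaced. -/
theorem card_pow_mul_sum_perm_le {m : ℕ} {V : Type*} [AddCommGroup V]
    {φ : V → ℝ} (hφ : ∀ x d, 2 * φ x ≤ φ (x + d) + φ (x - d)) (v : Fin m → V) :
    ∀ (s : ℕ) (g : Fin s → Fin m), Function.Injective g → ∀ x : V,
    (m : ℝ) ^ s * ∑ π : Equiv.Perm (Fin m), φ (x + ∑ i, v (π (g i))) ≤
      (m.factorial : ℝ) * ∑ f : Fin s → Fin m, φ (x + ∑ i, v (f i)) := by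
  intro s
  induction s with
  | zero => intro g _ x; simp [Fintype.card_perm]
  | succ s ih =>
    intro g hg x
    have hg' : Function.Injective (fun i : Fin s => g i.succ) :=
      hg.comp (Fin.succ_injective s)
    have hb : g 0 ∉ Set.range (fun i : Fin s => g i.succ) := by
      rintro ⟨i, hi⟩
      exact Fin.succ_ne_zero i (hg hi)
    have step : (m : ℝ) * ∑ π : Equiv.Perm (Fin m), φ (x + ∑ i, v (π (g i))) ≤
        ∑ a, ∑ π : Equiv.Perm (Fin m), φ (x + v a + ∑ i : Fin s, v (π (g i.succ))) := by
      have h1 : ∑ a, ∑ π : Equiv.Perm (Fin m), φ (x + v a + ∑ i : Fin s, v (π (g i.succ))) =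
          ∑ a, ∑ π : Equiv.Perm (Fin m), φ (x + v (π a) + ∑ i : Fin s, v (π (g i.succ))) := by
        rw [Finset.sum_comm, Finset.sum_comm (s := (Finset.univ : Finset (Fin m)))]
        refine Finset.sum_congr rfl fun π _ => ?_
        exact (Equiv.sum_comp π
          (fun a => φ (x + v a + ∑ i : Fin s, v (π (g i.succ))))).symm
      have h2 := Finset.card_nsmul_le_sum (Finset.univ : Finset (Fin m)) _ _
        fun a _ => sum_perm_le_sum_perm_repeat hφ v _ hg' (g 0) hb a x
      rw [h1]
      simpa [Fin.sum_univ_succ] using h2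
    calc (m : ℝ) ^ (s + 1) * ∑ π : Equiv.Perm (Fin m), φ (x + ∑ i, v (π (g i)))
        = (m : ℝ) ^ s * (m * ∑ π : Equiv.Perm (Fin m), φ (x + ∑ i, v (π (g i)))) := by ring
      _ ≤ (m : ℝ) ^ s * ∑ a, ∑ π : Equiv.Perm (Fin m),
            φ (x + v a + ∑ i : Fin s, v (π (g i.succ))) := by gcongr
      _ = ∑ a, (m : ℝ) ^ s * ∑ π : Equiv.Perm (Fin m),
            φ (x + v a + ∑ i : Fin s, v (π (g i.succ))) := by rw [Finset.mul_sum]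
      _ ≤ ∑ a, (m.factorial : ℝ) * ∑ f : Fin s → Fin m, φ (x + v a + ∑ i, v (f i)) :=
          Finset.sum_le_sum fun a _ => ih _ hg' (x + v a)
      _ = _ := by
          rw [← Finset.mul_sum, sum_fin_succ_fun]
          simp [Fin.sum_univ_succ, add_assoc]

open Classical in
/-- Hoeffding's comparison of sampling without and with replacement. -/
theorem card_pow_mul_sum_injective_le {m : ℕ} {V : Type*} [AddCommGroup V]
    {φ : V → ℝ} (hφ : ∀ x d, 2 * φ x ≤ φ (x + d) + φ (x - d)) (v : Fin m → V) (s : ℕ) :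
    (m : ℝ) ^ s * ∑ f : Fin s → Fin m with Function.Injective f, φ (∑ i, v (f i)) ≤
      (m.descFactorial s : ℝ) * ∑ f : Fin s → Fin m, φ (∑ i, v (f i)) := by
  set W := ∑ f : Fin s → Fin m, φ (∑ i, v (f i)) with hW
  set I := ∑ f : Fin s → Fin m with Function.Injective f, φ (∑ i, v (f i)) with hI
  have hcard : (Finset.univ.filter fun f : Fin s → Fin m => Function.Injective f).card =
      m.descFactorial s := by
    have h := Fintype.card_embedding_eq (α := Fin s) (β := Fin m)
    rw [Fintype.card_fin, Fintype.card_fin] at h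
    rw [← h, ← Fintype.card_subtype]
    exact Fintype.card_congr (Equiv.subtypeInjectiveEquivEmbedding _ _)
  -- Composition with a permutation permutes the injective maps, so averaging over permutations
  -- leaves `I` unchanged.
  have h1 : (m.factorial : ℝ) * I = ∑ f : Fin s → Fin m with Function.Injective f,
      ∑ π : Equiv.Perm (Fin m), φ (∑ i, v (π (f i))) := by
    rw [Finset.sum_comm]
    have : ∀ π : Equiv.Perm (Fin m), ∑ f : Fin s → Fin m with Function.Injective f,
        φ (∑ i, v (π (f i))) = I := by
      intro π
      refine Finset.sum_bij' (fun f _ => π ∘ f) (fun f _ => π.symm ∘ f) ?_ ?_ ?_ ?_ ?_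
      · intro f hf
        simp only [Finset.mem_filter, Finset.mem_univ, true_and] at hf ⊢
        exact π.injective.comp hf
      · intro f hf
        simp only [Finset.mem_filter, Finset.mem_univ, true_and] at hf ⊢
        exact π.symm.injective.comp hf
      · intro f _; funext i; simp
      · intro f _; funext i; simp
      · intro f _; rfl
    simp [this, Fintype.card_perm]
  have h2 : (m : ℝ) ^ s * ((m.factorial : ℝ) * I) ≤
      (m.descFactorial s : ℝ) * ((m.factorial : ℝ) * W) := by
    rw [h1, Finset.mul_sum, ← hcard, ← nsmul_eq_mul]
    refine Finset.sum_le_card_nsmul _ _ _ fun f hf => ?_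
    have := card_pow_mul_sum_perm_le hφ v s f (Finset.mem_filter.mp hf).2 0
    simpa using this
  have h3 : (0 : ℝ) < m.factorial := by exact_mod_cast m.factorial_pos
  refine le_of_mul_le_mul_left ?_ h3
  linarith

/-- The triangle inequality and `cosh p + cosh q = 2 cosh ((p+q)/2) cosh ((p-q)/2)`. This is the
midpoint convexity required by Hoeffding's comparison. -/
theorem two_mul_cosh_norm_le {V : Type*} [SeminormedAddCommGroup V] [NormedSpace ℝ V] {t : ℝ}
    (ht : 0 ≤ t) (x d : V) :
    2 * Real.cosh (t * ‖x‖) ≤ Real.cosh (t * ‖x + d‖) + Real.cosh (t * ‖x - d‖) := by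
  set p := t * ‖x + d‖
  set q := t * ‖x - d‖
  have hp : 0 ≤ p := by positivity
  have hq : 0 ≤ q := by positivity
  have hx : t * ‖x‖ ≤ (p + q) / 2 := by
    have h := norm_add_le (x + d) (x - d)
    have h2 : ‖(x + d) + (x - d)‖ = 2 * ‖x‖ := by
      rw [show (x + d) + (x - d) = (2 : ℝ) • x by rw [two_smul]; abel, norm_smul]
      norm_num
    rw [h2] at h
    have := mul_le_mul_of_nonneg_left h ht
    simp only [p, q]; linarith
  have h1 : Real.cosh (t * ‖x‖) ≤ Real.cosh ((p + q) / 2) := by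
    rw [Real.cosh_le_cosh, abs_of_nonneg (by positivity), abs_of_nonneg (by positivity)]
    exact hx
  have e1 : Real.cosh p = Real.cosh ((p + q) / 2 + (p - q) / 2) := by congr 1; ring
  have e2 : Real.cosh q = Real.cosh ((p + q) / 2 - (p - q) / 2) := by congr 1; ring
  rw [e1, e2, Real.cosh_add, Real.cosh_sub]
  nlinarith [Real.one_le_cosh ((p - q) / 2), Real.cosh_pos ((p + q) / 2)]

/-! ### Sums of vectors drawn with replacement -/

section InnerProduct
variable {V : Type*} [NormedAddCommGroup V] [InnerProductSpace ℝ V] {m : ℕ}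

/-- Cross terms vanish because `v` is centred, so variances add up. -/
theorem sum_norm_sq_sum_le (v : Fin m → V) (hv : ∑ i, v i = 0) {B : ℝ}
    (hB : ∑ i, ‖v i‖ ^ 2 ≤ m * B) : ∀ (s : ℕ) (x : V),
    ∑ f : Fin s → Fin m, ‖x + ∑ i, v (f i)‖ ^ 2 ≤ (m : ℝ) ^ s * (‖x‖ ^ 2 + s * B) := by
  intro s
  induction s with
  | zero => intro x; simp
  | succ s ih =>
    intro x
    have h1 : ∑ a, ‖x + v a‖ ^ 2 ≤ m * (‖x‖ ^ 2 + B) := by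
      have : ∑ a, ‖x + v a‖ ^ 2 = m * ‖x‖ ^ 2 + ∑ a, ‖v a‖ ^ 2 := by
        simp_rw [norm_add_sq_real]
        rw [Finset.sum_add_distrib, Finset.sum_add_distrib, ← Finset.mul_sum, ← inner_sum, hv]
        simp
      rw [this]; linarith
    calc ∑ f : Fin (s + 1) → Fin m, ‖x + ∑ i, v (f i)‖ ^ 2
        = ∑ a, ∑ f : Fin s → Fin m, ‖(x + v a) + ∑ i, v (f i)‖ ^ 2 := by
          rw [sum_fin_succ_fun]; simp [Fin.sum_univ_succ, add_assoc]
      _ ≤ ∑ a, (m : ℝ) ^ s * (‖x + v a‖ ^ 2 + s * B) := Finset.sum_le_sum fun a _ => ih _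
      _ = (m : ℝ) ^ s * (∑ a, ‖x + v a‖ ^ 2 + m * (s * B)) := by
          rw [← Finset.mul_sum, Finset.sum_add_distrib]; simp
      _ ≤ (m : ℝ) ^ s * (m * (‖x‖ ^ 2 + B) + m * (s * B)) := by gcongr
      _ = _ := by push_cast; ring

/-- `‖x + y‖²` is at most the mean of `(‖x‖ ± b)²` with weights `(1 ± z) / 2`, and `cosh` is a power
series in the square with nonnegative coefficients, so convexity applies term by term. The bound is
affine in `y`: averaging over centred `y` leaves `cosh b * cosh ‖x‖`. -/
theorem cosh_norm_add_le (x y : V) {b : ℝ} (hb : 0 < b) (hy : ‖y‖ ≤ b) (hx : x ≠ 0) :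
    Real.cosh ‖x + y‖ ≤ (1 + inner ℝ x y / (‖x‖ * b)) / 2 * Real.cosh (‖x‖ + b) +
      (1 - inner ℝ x y / (‖x‖ * b)) / 2 * Real.cosh (‖x‖ - b) := by
  have hx' : 0 < ‖x‖ := norm_pos_iff.mpr hx
  set z := inner ℝ x y / (‖x‖ * b) with hz
  have hin : |inner ℝ x y| ≤ ‖x‖ * b :=
    (abs_real_inner_le_norm x y).trans (by gcongr)
  have hz1 : |z| ≤ 1 := by
    rw [hz, abs_div, abs_of_pos (mul_pos hx' hb)]
    exact div_le_one_of_le₀ hin (by positivity)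
  obtain ⟨hz2, hz3⟩ := abs_le.mp hz1
  have hzin : inner ℝ x y = z * (‖x‖ * b) := by rw [hz]; field_simp
  have hsq : ‖x + y‖ ^ 2 ≤ (1 + z) / 2 * (‖x‖ + b) ^ 2 + (1 - z) / 2 * (‖x‖ - b) ^ 2 := by
    rw [norm_add_sq_real, hzin]
    nlinarith [pow_le_pow_left₀ (norm_nonneg y) hy 2]
  refine hasSum_le (fun k => ?_) (Real.hasSum_cosh ‖x + y‖)
    (((Real.hasSum_cosh (‖x‖ + b)).mul_left ((1 + z) / 2)).add
      ((Real.hasSum_cosh (‖x‖ - b)).mul_left ((1 - z) / 2)))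
  rw [← mul_div_assoc, ← mul_div_assoc, ← add_div]
  gcongr
  rw [pow_mul, pow_mul, pow_mul]
  refine (pow_le_pow_left₀ (by positivity) hsq k).trans ?_
  have ha : 0 ≤ (1 + z) / 2 := by linarith
  have hb' : 0 ≤ (1 - z) / 2 := by linarith
  have := (convexOn_pow k).2 (Set.mem_Ici.mpr (sq_nonneg (‖x‖ + b)))
    (Set.mem_Ici.mpr (sq_nonneg (‖x‖ - b))) ha hb' (by ring)
  simpa using this

theorem sum_cosh_norm_add_le (v : Fin m → V) (hv : ∑ i, v i = 0) {b : ℝ} (hb : 0 < b)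
    (hvb : ∀ i, ‖v i‖ ≤ b) (x : V) :
    ∑ a, Real.cosh ‖x + v a‖ ≤ m * Real.cosh b * Real.cosh ‖x‖ := by
  by_cases hx : x = 0
  · subst hx
    have := Finset.sum_le_card_nsmul (Finset.univ : Finset (Fin m))
      (fun a => Real.cosh ‖0 + v a‖) (Real.cosh b) fun a _ => by
        rw [zero_add, Real.cosh_le_cosh, abs_of_nonneg (norm_nonneg _), abs_of_pos hb]
        exact hvb a
    simpa using this
  · refine (Finset.sum_le_sum fun a _ => cosh_norm_add_le x (v a) hb (hvb a) hx).trans_eq ?_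
    have hz : ∑ a, inner ℝ x (v a) / (‖x‖ * b) = 0 := by
      rw [← Finset.sum_div, ← inner_sum, hv]; simp
    rw [Finset.sum_add_distrib, ← Finset.sum_mul, ← Finset.sum_mul, ← Finset.sum_div,
      ← Finset.sum_div, Finset.sum_add_distrib, Finset.sum_sub_distrib, hz, Real.cosh_add,
      Real.cosh_sub]
    simp
    ring

theorem sum_cosh_norm_sum_le (v : Fin m → V) (hv : ∑ i, v i = 0) {b : ℝ} (hb : 0 < b)
    (hvb : ∀ i, ‖v i‖ ≤ b) : ∀ (s : ℕ) (x : V),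
    ∑ f : Fin s → Fin m, Real.cosh ‖x + ∑ i, v (f i)‖ ≤
      (m * Real.cosh b) ^ s * Real.cosh ‖x‖ := by
  intro s
  induction s with
  | zero => intro x; simp
  | succ s ih =>
    intro x
    have hc := (Real.cosh_pos b).le
    calc ∑ f : Fin (s + 1) → Fin m, Real.cosh ‖x + ∑ i, v (f i)‖
        = ∑ a, ∑ f : Fin s → Fin m, Real.cosh ‖(x + v a) + ∑ i, v (f i)‖ := by
          rw [sum_fin_succ_fun]; simp [Fin.sum_univ_succ, add_assoc]
      _ ≤ ∑ a, (m * Real.cosh b) ^ s * Real.cosh ‖x + v a‖ := Finset.sum_le_sum fun a _ => ih _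
      _ = (m * Real.cosh b) ^ s * ∑ a, Real.cosh ‖x + v a‖ := by rw [← Finset.mul_sum]
      _ ≤ (m * Real.cosh b) ^ s * (m * Real.cosh b * Real.cosh ‖x‖) := by
          gcongr
          exact sum_cosh_norm_add_le v hv hb hvb x
      _ = _ := by ring

theorem sum_cosh_mul_norm_sum_le (v : Fin m → V) (hv : ∑ i, v i = 0) {b : ℝ} (hb : 0 < b)
    (hvb : ∀ i, ‖v i‖ ≤ b) (s : ℕ) {t : ℝ} (ht : 0 < t) :
    ∑ f : Fin s → Fin m, Real.cosh (t * ‖∑ i, v (f i)‖) ≤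
      (m : ℝ) ^ s * Real.exp (s * (t * b) ^ 2 / 2) := by
  have h := sum_cosh_norm_sum_le (fun i => t • v i) (by rw [← Finset.smul_sum, hv, smul_zero])
    (mul_pos ht hb) (fun i => by
      rw [norm_smul, Real.norm_of_nonneg ht.le]; gcongr; exact hvb i) s 0
  simp_rw [← Finset.smul_sum, zero_add, norm_smul, Real.norm_of_nonneg ht.le] at h
  refine h.trans ?_
  rw [norm_zero, Real.cosh_zero, mul_one, mul_pow, mul_div_assoc, Real.exp_nat_mul]
  gcongr
  exact Real.cosh_le_exp_half_sq _

theorem sum_norm_sub_mean_sq_le (v : Fin m → V) {M : V} (hM : ∑ i, v i = (m : ℝ) • M) {U : ℝ}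
    (hU : ∀ i, ‖v i‖ ≤ U) : ∑ i, ‖v i - M‖ ^ 2 ≤ m * U ^ 2 := by
  have h : ∑ i, ‖v i - M‖ ^ 2 = ∑ i, ‖v i‖ ^ 2 - m * ‖M‖ ^ 2 := by
    simp_rw [norm_sub_sq_real]
    rw [Finset.sum_add_distrib, Finset.sum_sub_distrib, ← Finset.mul_sum, ← sum_inner, hM,
      inner_smul_left, real_inner_self_eq_norm_sq]
    simp
    ring
  have h2 : ∑ i, ‖v i‖ ^ 2 ≤ m * U ^ 2 := by
    have := Finset.sum_le_card_nsmul (Finset.univ : Finset (Fin m)) (fun i => ‖v i‖ ^ 2) (U ^ 2)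
      fun i _ => pow_le_pow_left₀ (norm_nonneg _) (hU i) 2
    simpa using this
  have : 0 ≤ m * ‖M‖ ^ 2 := by positivity
  linarith

end InnerProduct

theorem sum_sub_mean_eq_zero {V : Type*} [AddCommGroup V] [Module ℝ V] {m : ℕ} (v : Fin m → V)
    {M : V} (hM : ∑ i, v i = (m : ℝ) • M) : ∑ i, (v i - M) = 0 := by
  rw [Finset.sum_sub_distrib, hM]
  simp [Nat.cast_smul_eq_nsmul]

theorem norm_mean_le {V : Type*} [NormedAddCommGroup V] [NormedSpace ℝ V] {m : ℕ} (hm : 0 < m)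
    (v : Fin m → V) {M : V} (hM : ∑ i, v i = (m : ℝ) • M) {U : ℝ} (hU : ∀ i, ‖v i‖ ≤ U) :
    ‖M‖ ≤ U := by
  have h1 : ‖(m : ℝ) • M‖ ≤ m * U := by
    rw [← hM]
    refine (norm_sum_le _ _).trans ?_
    have := Finset.sum_le_card_nsmul (Finset.univ : Finset (Fin m)) (fun i => ‖v i‖) U
      fun i _ => hU i
    simpa using this
  rw [norm_smul, Real.norm_natCast] at h1
  exact le_of_mul_le_mul_left h1 (by exact_mod_cast hm)

/-! ### Moments of sums of self-adjoint operators drawn with replacement -/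

section Operators
variable {E : Type*} [NormedAddCommGroup E] [InnerProductSpace ℝ E] [FiniteDimensional ℝ E]

/-- The trace of a continuous linear map, as a continuous linear functional. -/
noncomputable def traceCLM (E : Type*) [NormedAddCommGroup E] [InnerProductSpace ℝ E]
    [FiniteDimensional ℝ E] : (E →L[ℝ] E) →L[ℝ] ℝ :=
  LinearMap.toContinuousLinearMap
    ((LinearMap.trace ℝ E).comp (ContinuousLinearMap.coeLM ℝ))

theorem traceCLM_mul_comm (A B : E →L[ℝ] E) : traceCLM E (A * B) = traceCLM E (B * A) :=
  LinearMap.trace_mul_comm ℝ (A : E →ₗ[ℝ] E) B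

theorem traceCLM_eq_sum_inner {ι : Type*} [Fintype ι] (b : OrthonormalBasis ι ℝ E)
    (A : E →L[ℝ] E) : traceCLM E A = ∑ i, inner ℝ (b i) (A (b i)) :=
  LinearMap.trace_eq_sum_inner _ b

theorem exists_eigenbasis {A : E →L[ℝ] E} (hA : (A : E →ₗ[ℝ] E).IsSymmetric) :
    ∃ (b : OrthonormalBasis (Fin (Module.finrank ℝ E)) ℝ E)
      (l : Fin (Module.finrank ℝ E) → ℝ), ∀ i, A (b i) = l i • b i :=
  ⟨hA.eigenvectorBasis rfl, hA.eigenvalues rfl, fun i => hA.apply_eigenvectorBasis rfl i⟩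

theorem pow_apply_eigenvector {A : E →L[ℝ] E} {v : E} {l : ℝ} (h : A v = l • v) (k : ℕ) :
    (A ^ k) v = l ^ k • v := by
  induction k with
  | zero => simp
  | succ k ih => rw [pow_succ', mul_apply_eq_comp, ih, map_smul, h, smul_smul, pow_succ]

theorem inner_pow_eigenbasis {ι : Type*} [Fintype ι] {A : E →L[ℝ] E} (b : OrthonormalBasis ι ℝ E)
    {l : ι → ℝ} (h : ∀ i, A (b i) = l i • b i) (k : ℕ) (y : E) :
    inner ℝ y ((A ^ k) y) = ∑ i, l i ^ k * inner ℝ (b i) y ^ 2 := by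
  have hy : (A ^ k) y = ∑ i, (l i ^ k * inner ℝ (b i) y) • b i := by
    conv_lhs => rw [← b.sum_repr' y]
    rw [map_sum]
    refine Finset.sum_congr rfl fun i _ => ?_
    rw [map_smul, pow_apply_eigenvector (h i), smul_smul, mul_comm]
  rw [hy, inner_sum]
  refine Finset.sum_congr rfl fun i _ => ?_
  rw [inner_smul_right, real_inner_comm]
  ring

theorem traceCLM_pow_eigenbasis {ι : Type*} [Fintype ι] {A : E →L[ℝ] E}
    (b : OrthonormalBasis ι ℝ E) {l : ι → ℝ} (h : ∀ i, A (b i) = l i • b i) (k : ℕ) :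
    traceCLM E (A ^ k) = ∑ i, l i ^ k := by
  rw [traceCLM_eq_sum_inner b]
  refine Finset.sum_congr rfl fun i _ => ?_
  rw [pow_apply_eigenvector (h i), inner_smul_right]
  simp

/-- A rearrangement inequality: `|x|ⁱ - |y|ⁱ` and `|x|ʲ - |y|ʲ` have the same sign. -/
theorem pow_mul_pow_add_le (x y : ℝ) {i j k : ℕ} (h : i + j = 2 * k) :
    x ^ i * y ^ j + y ^ i * x ^ j ≤ x ^ (2 * k) + y ^ (2 * k) := by
  have e : ∀ z : ℝ, z ^ (2 * k) = |z| ^ i * |z| ^ j := fun z => by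
    rw [← pow_add, h, pow_mul, pow_mul, sq_abs]
  have h1 : x ^ i * y ^ j ≤ |x| ^ i * |y| ^ j := by
    rw [← abs_pow, ← abs_pow, ← abs_mul]; exact le_abs_self _
  have h2 : y ^ i * x ^ j ≤ |y| ^ i * |x| ^ j := by
    rw [← abs_pow, ← abs_pow, ← abs_mul]; exact le_abs_self _
  have h3 : 0 ≤ (|x| ^ i - |y| ^ i) * (|x| ^ j - |y| ^ j) := by
    rcases le_total |x| |y| with hxy | hxy
    · exact mul_nonneg_of_nonpos_of_nonpos
        (sub_nonpos.mpr (pow_le_pow_left₀ (abs_nonneg _) hxy i))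
        (sub_nonpos.mpr (pow_le_pow_left₀ (abs_nonneg _) hxy j))
    · exact mul_nonneg (sub_nonneg.mpr (pow_le_pow_left₀ (abs_nonneg _) hxy i))
        (sub_nonneg.mpr (pow_le_pow_left₀ (abs_nonneg _) hxy j))
  rw [e x, e y]
  nlinarith

/-- `tr (Y Aⁱ Y Aʲ) ≤ ‖Y‖² tr Aⁱ⁺ʲ` for self-adjoint `A`, `Y` and even `i + j`. -/
theorem traceCLM_mul_pow_mul_pow_le {A Y : E →L[ℝ] E} (hA : (A : E →ₗ[ℝ] E).IsSymmetric)
    (hY : (Y : E →ₗ[ℝ] E).IsSymmetric) {c : ℝ} (hYc : ‖Y‖ ≤ c) {i j k : ℕ} (h : i + j = 2 * k) :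
    traceCLM E (Y * A ^ i * Y * A ^ j) ≤ c ^ 2 * traceCLM E (A ^ (2 * k)) := by
  obtain ⟨b, l, hb⟩ := exists_eigenbasis hA
  set y := fun p q => inner ℝ (b p) (Y (b q)) with hy
  have hsymm : ∀ p q, y p q = y q p := fun p q => by
    simp only [hy]
    rw [real_inner_comm]
    exact hY (b q) (b p)
  -- In an eigenbasis of `A` the trace is a sum against the symmetric weights `y p q ^ 2`.
  -- Symmetrizing in `p`, `q` allows `pow_mul_pow_add_le` to be applied entrywise.
  have h1 : traceCLM E (Y * A ^ i * Y * A ^ j) = ∑ q, ∑ p, l p ^ i * l q ^ j * y p q ^ 2 := by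
    rw [traceCLM_eq_sum_inner b]
    refine Finset.sum_congr rfl fun q _ => ?_
    simp only [mul_apply_eq_comp]
    rw [pow_apply_eigenvector (hb q), map_smul, map_smul, map_smul, inner_smul_right]
    have := hY (b q) ((A ^ i) (Y (b q)))
    simp only [ContinuousLinearMap.coe_coe] at this
    rw [← this, inner_pow_eigenbasis b hb, Finset.mul_sum]
    refine Finset.sum_congr rfl fun p _ => ?_
    ring
  have h2 : ∑ q, ∑ p, l p ^ i * l q ^ j * y p q ^ 2 =
      ∑ q, ∑ p, l q ^ i * l p ^ j * y p q ^ 2 := by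
    rw [Finset.sum_comm]
    refine Finset.sum_congr rfl fun q _ => Finset.sum_congr rfl fun p _ => ?_
    rw [hsymm p q]
  have h3 : ∑ q, ∑ p, l p ^ (2 * k) * y p q ^ 2 = ∑ q, ∑ p, l q ^ (2 * k) * y p q ^ 2 := by
    rw [Finset.sum_comm]
    refine Finset.sum_congr rfl fun q _ => Finset.sum_congr rfl fun p _ => ?_
    rw [hsymm p q]
  have h4 : ∑ q, ∑ p, l p ^ i * l q ^ j * y p q ^ 2 + ∑ q, ∑ p, l q ^ i * l p ^ j * y p q ^ 2 ≤
      ∑ q, ∑ p, l p ^ (2 * k) * y p q ^ 2 + ∑ q, ∑ p, l q ^ (2 * k) * y p q ^ 2 := by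
    rw [← Finset.sum_add_distrib, ← Finset.sum_add_distrib]
    refine Finset.sum_le_sum fun q _ => ?_
    rw [← Finset.sum_add_distrib, ← Finset.sum_add_distrib]
    refine Finset.sum_le_sum fun p _ => ?_
    nlinarith [pow_mul_pow_add_le (l p) (l q) h, sq_nonneg (y p q)]
  have h5 : ∑ q, ∑ p, l q ^ (2 * k) * y p q ^ 2 ≤ c ^ 2 * ∑ q, l q ^ (2 * k) := by
    rw [Finset.mul_sum]
    refine Finset.sum_le_sum fun q _ => ?_
    rw [← Finset.mul_sum, mul_comm]
    refine mul_le_mul_of_nonneg_right ?_ (by rw [pow_mul]; positivity)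
    have e : ∑ p, y p q ^ 2 = ‖Y (b q)‖ ^ 2 := by
      rw [← b.sum_sq_norm_inner_right (Y (b q))]
      simp [hy]
    rw [e]
    refine pow_le_pow_left₀ (norm_nonneg _) ((Y.le_opNorm _).trans ?_) 2
    simpa using hYc
  rw [h1, traceCLM_pow_eigenbasis b hb]
  linarith

/-- The norm is attained at an eigenvalue of largest modulus, and the even powers of the others only
add to the trace. -/
theorem norm_pow_le_traceCLM [Nontrivial E] {A : E →L[ℝ] E}
    (hA : (A : E →ₗ[ℝ] E).IsSymmetric) (k : ℕ) : ‖A‖ ^ (2 * k) ≤ traceCLM E (A ^ (2 * k)) := by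
  obtain ⟨b, l, hb⟩ := exists_eigenbasis hA
  have : Nonempty (Fin (Module.finrank ℝ E)) := ⟨⟨0, Module.finrank_pos⟩⟩
  obtain ⟨p, hp⟩ := Finite.exists_max fun i => |l i|
  have hnorm : ‖A‖ ≤ |l p| := by
    refine A.opNorm_le_bound (abs_nonneg _) fun x => ?_
    refine abs_le_of_sq_le_sq' ?_ (by positivity) |>.2
    have h2 := inner_pow_eigenbasis b hb 2 x
    have h3 : ‖A x‖ ^ 2 = inner ℝ x ((A ^ 2) x) := by
      rw [← real_inner_self_eq_norm_sq, pow_two]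
      exact hA x (A x)
    rw [h3, h2, mul_pow, ← b.sum_sq_norm_inner_right x, Finset.mul_sum]
    refine Finset.sum_le_sum fun i _ => ?_
    simp only [Real.norm_eq_abs, sq_abs]
    exact mul_le_mul_of_nonneg_right (sq_le_sq.mpr (hp i)) (sq_nonneg _)
  rw [traceCLM_pow_eigenbasis b hb]
  calc ‖A‖ ^ (2 * k) ≤ |l p| ^ (2 * k) := by gcongr
    _ = l p ^ (2 * k) := by rw [pow_mul, sq_abs, ← pow_mul]
    _ ≤ _ := Finset.single_le_sum (f := fun i => l i ^ (2 * k))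
        (fun i _ => by rw [pow_mul]; positivity) (Finset.mem_univ p)

/-- The product rule without commutativity. `Z = 1` gives the first derivative of the trace of a
power, and `Z = Y` the second. -/
theorem hasDerivAt_mul_pow (Z X Y : E →L[ℝ] E) (N : ℕ) (t : ℝ) :
    HasDerivAt (fun t : ℝ => traceCLM E (Z * (X + t • Y) ^ N))
      (∑ i ∈ Finset.range N,
        traceCLM E (Z * (X + t • Y) ^ i * Y * (X + t • Y) ^ (N - 1 - i))) t := by
  have hpow : ∀ N : ℕ, HasDerivAt (fun t : ℝ => (X + t • Y) ^ N)
      (∑ i ∈ Finset.range N, (X + t • Y) ^ i * Y * (X + t • Y) ^ (N - 1 - i)) t := by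
    intro N
    induction N with
    | zero => simpa using hasDerivAt_const t (1 : E →L[ℝ] E)
    | succ N ih =>
      have h1 : HasDerivAt (fun t : ℝ => X + t • Y) Y t := by
        simpa using ((hasDerivAt_id t).smul_const Y).const_add X
      have h2 := ih.mul h1
      simp_rw [pow_succ]
      refine h2.congr_deriv ?_
      rw [Finset.sum_range_succ, Finset.sum_mul]
      congr 1
      · refine Finset.sum_congr rfl fun i hi => ?_
        have : N + 1 - 1 - i = N - 1 - i + 1 := by
          have := Finset.mem_range.mp hi; omega
        rw [this, pow_succ]
        simp only [mul_assoc]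
      · simp
  have h := (traceCLM E).hasFDerivAt.comp_hasDerivAt t ((hpow N).const_mul Z)
  simpa [Finset.mul_sum, map_sum, mul_assoc, Function.comp_def] using h

theorem hasDerivAt_traceCLM_pow (X Y : E →L[ℝ] E) (N : ℕ) (t : ℝ) :
    HasDerivAt (fun t : ℝ => traceCLM E ((X + t • Y) ^ (N + 1)))
      ((N + 1) * traceCLM E (Y * (X + t • Y) ^ N)) t := by
  have h := hasDerivAt_mul_pow 1 X Y (N + 1) t
  simp only [one_mul] at h
  convert h using 1
  have : ∀ i ∈ Finset.range (N + 1), traceCLM E ((X + t • Y) ^ i * Y *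
      (X + t • Y) ^ (N + 1 - 1 - i)) = traceCLM E (Y * (X + t • Y) ^ N) := by
    intro i hi
    rw [mul_assoc, traceCLM_mul_comm, mul_assoc, ← pow_add]
    congr 3
    have := Finset.mem_range.mp hi; omega
  rw [Finset.sum_congr rfl this]
  simp
-- Moment bounds by interpolation
/-- The bound `C (2k)! / k! βᵏ` for the `2k`-th moment, shaped like that of a Gaussian variable. -/
noncomputable def momentBound (C β : ℝ) (k : ℕ) : ℝ :=
  C * ((2 * k).factorial : ℝ) / (k.factorial : ℝ) * β ^ k

theorem momentBound_mono {C β β' : ℝ} (hC : 0 ≤ C) (hβ : 0 ≤ β) (h : β ≤ β') (k : ℕ) :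
    momentBound C β k ≤ momentBound C β' k := by
  unfold momentBound; gcongr

/-- The factorials are chosen so that the derivative in `t` of the bound of order `k + 1` is
`(2k+2)(2k+1) c t` times the bound of order `k`, which matches the second derivative of a trace of a
power. -/
theorem hasDerivAt_momentBound (C β c : ℝ) (k : ℕ) (t : ℝ) :
    HasDerivAt (fun t => momentBound C (β + t ^ 2 * c / 2) (k + 1))
      ((2 * k + 2) * (2 * k + 1) * c * t * momentBound C (β + t ^ 2 * c / 2) k) t := by
  have h0 : HasDerivAt (fun t : ℝ => β + t ^ 2 * c / 2) (t * c) t := by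
    have := (((hasDerivAt_pow 2 t).mul_const c).div_const 2).const_add β
    refine this.congr_deriv ?_
    norm_num; ring
  have h := (h0.pow (k + 1)).const_mul (C * ((2 * (k + 1)).factorial : ℝ) / ((k + 1).factorial : ℝ))
  refine h.congr_deriv ?_
  unfold momentBound
  have h1 : ((2 * (k + 1)).factorial : ℝ) = (2 * k + 2) * (2 * k + 1) * (2 * k).factorial := by
    rw [show 2 * (k + 1) = 2 * k + 1 + 1 by ring, Nat.factorial_succ, Nat.factorial_succ]
    push_cast; ring
  have h2 : ((k + 1).factorial : ℝ) = (k + 1) * k.factorial := by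
    rw [Nat.factorial_succ]; push_cast; ring
  have h3 : (k.factorial : ℝ) ≠ 0 := by exact_mod_cast k.factorial_ne_zero
  have h4 : ((k : ℝ) + 1) ≠ 0 := by positivity
  rw [h1, h2]
  push_cast
  field_simp

/-- Comparison of two functions through a bound on the second derivative of the smaller one. -/
theorem le_of_second_deriv_le {q q' q'' r ρ : ℝ → ℝ} {K : ℝ} (hK : 0 ≤ K)
    (hq : ∀ t, HasDerivAt q (q' t) t) (hq' : ∀ t, HasDerivAt q' (q'' t) t)
    (hr : ∀ t, HasDerivAt r (K * t * ρ t) t) (h0 : q 0 ≤ r 0) (h0' : q' 0 = 0)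
    (hρ : ∀ u t, 0 ≤ u → u ≤ t → ρ u ≤ ρ t) (h : ∀ t, 0 ≤ t → q'' t ≤ K * ρ t)
    {t : ℝ} (ht : 0 ≤ t) : q t ≤ r t := by
  -- Since `ρ` is nondecreasing, `K * ρ t` bounds `q''` on all of `[0, t]`, and `q'` starts from
  -- `0`.
  have h1 : ∀ t, 0 ≤ t → q' t ≤ K * t * ρ t := by
    intro t ht
    have := (convex_Icc 0 t).image_sub_le_mul_sub_of_deriv_le
      (f := q') (fun u _ => (hq' u).continuousAt.continuousWithinAt)
      (fun u _ => (hq' u).differentiableAt.differentiableWithinAt) (C := K * ρ t)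
      (fun u hu => by
        rw [interior_Icc] at hu
        rw [(hq' u).deriv]
        exact (h u hu.1.le).trans (mul_le_mul_of_nonneg_left (hρ u t hu.1.le hu.2.le) hK))
      0 (Set.left_mem_Icc.mpr ht) t (Set.right_mem_Icc.mpr ht) ht
    rw [h0'] at this
    linarith
  have hmono : MonotoneOn (fun t => r t - q t) (Set.Ici 0) := by
    refine monotoneOn_of_deriv_nonneg (convex_Ici 0)
      (fun u _ => ((hr u).sub (hq u)).continuousAt.continuousWithinAt)
      (fun u _ => ((hr u).sub (hq u)).differentiableAt.differentiableWithinAt) fun u hu => ?_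
    rw [interior_Ici] at hu
    have hd := ((hr u).sub (hq u)).deriv
    have e : (fun t => r t - q t) = r - q := rfl
    rw [e, hd]
    have := h1 u (le_of_lt hu)
    linarith
  have := hmono (Set.mem_Ici.mpr le_rfl) (Set.mem_Ici.mpr ht) ht
  simp only at this
  linarith

theorem isSymmetric_add_smul {X Y : E →L[ℝ] E} (hX : (X : E →ₗ[ℝ] E).IsSymmetric)
    (hY : (Y : E →ₗ[ℝ] E).IsSymmetric) (t : ℝ) :
    ((X + t • Y : E →L[ℝ] E) : E →ₗ[ℝ] E).IsSymmetric := by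
  intro x y
  have h1 := hX x y
  have h2 := hY x y
  simp only [ContinuousLinearMap.coe_coe] at h1 h2
  simp [inner_add_left, inner_add_right, inner_smul_left, inner_smul_right, h1, h2]

/-- Adding an independent centred self-adjoint summand of norm at most `c` increases the
parameter of the moment bound by `c² / 2`. -/
theorem sum_traceCLM_pow_add_le {ι κ : Type*} [Fintype ι] [Fintype κ] (X : ι → E →L[ℝ] E)
    (hX : ∀ f, (X f : E →ₗ[ℝ] E).IsSymmetric) (v : κ → E →L[ℝ] E)
    (hv : ∀ a, (v a : E →ₗ[ℝ] E).IsSymmetric) (hv0 : ∑ a, v a = 0) {c : ℝ}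
    (hvc : ∀ a, ‖v a‖ ≤ c) {C β : ℝ} (hC : 0 ≤ C) (hβ : 0 ≤ β)
    (hmom : ∀ k, ∑ f, traceCLM E (X f ^ (2 * k)) ≤ momentBound C β k) (k : ℕ) :
    ∀ t : ℝ, 0 ≤ t → ∑ f, ∑ a, traceCLM E ((X f + t • v a) ^ (2 * k)) ≤
      momentBound (Fintype.card κ * C) (β + t ^ 2 * c ^ 2 / 2) k := by
  have hC' : 0 ≤ Fintype.card κ * C := by positivity
  have hzero : ∀ k, ∑ f, ∑ a, traceCLM E ((X f + (0 : ℝ) • v a) ^ (2 * k)) ≤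
      momentBound (Fintype.card κ * C) β k := by
    intro k
    have h := mul_le_mul_of_nonneg_left (hmom k) (Nat.cast_nonneg (α := ℝ) (Fintype.card κ))
    have e : momentBound (Fintype.card κ * C) β k = Fintype.card κ * momentBound C β k := by
      unfold momentBound; ring
    rw [e]
    simpa [Finset.mul_sum] using h
  induction k with
  | zero =>
    intro t _
    have := hzero 0
    simpa [momentBound] using this
  | succ k ih =>
    intro t ht
    have hd1 : ∀ u : ℝ, HasDerivAt
        (fun u : ℝ => ∑ f, ∑ a, traceCLM E ((X f + u • v a) ^ (2 * (k + 1))))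
        (∑ f, ∑ a, (2 * k + 2) * traceCLM E (v a * (X f + u • v a) ^ (2 * k + 1))) u := by
      intro u
      refine HasDerivAt.fun_sum fun f _ => HasDerivAt.fun_sum fun a _ => ?_
      refine (hasDerivAt_traceCLM_pow (X f) (v a) (2 * k + 1) u).congr_deriv ?_
      push_cast; ring
    have hd2 : ∀ u : ℝ, HasDerivAt
        (fun u : ℝ => ∑ f, ∑ a, (2 * k + 2) * traceCLM E (v a * (X f + u • v a) ^ (2 * k + 1)))
        (∑ f, ∑ a, (2 * k + 2) * ∑ i ∈ Finset.range (2 * k + 1),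
          traceCLM E (v a * (X f + u • v a) ^ i * v a * (X f + u • v a) ^ (2 * k - i))) u := by
      intro u
      refine HasDerivAt.fun_sum fun f _ => HasDerivAt.fun_sum fun a _ => ?_
      exact (hasDerivAt_mul_pow (v a) (X f) (v a) (2 * k + 1) u).const_mul _
    have hr := hasDerivAt_momentBound (Fintype.card κ * C) β (c ^ 2) k
    -- Interpolation from `X` to `X + t v`: the first derivative vanishes at `0` because `v` is
    -- centred. Each of the `2k + 1` terms of the second is at most `c²` times the trace of order
    -- `2k`, to which the induction hypothesis applies at the same `u`.
    refine le_of_second_deriv_le (K := (2 * k + 2) * (2 * k + 1) * c ^ 2)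
      (ρ := fun t => momentBound (Fintype.card κ * C) (β + t ^ 2 * c ^ 2 / 2) k)
      (by positivity) hd1 hd2 (fun t => hr t) ?_ ?_ ?_ ?_ ht
    · have := hzero (k + 1)
      simpa using this
    · simp only [zero_smul, add_zero]
      refine Finset.sum_eq_zero fun f _ => ?_
      rw [← Finset.mul_sum, ← map_sum, ← Finset.sum_mul, hv0]
      simp
    · intro u t hu hut
      refine momentBound_mono hC' (by positivity) ?_ k
      gcongr
    · intro u hu
      have hsum : ∑ f, ∑ a, (2 * (k : ℝ) + 2) * ∑ i ∈ Finset.range (2 * k + 1),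
          traceCLM E (v a * (X f + u • v a) ^ i * v a * (X f + u • v a) ^ (2 * k - i)) ≤
          ∑ f, ∑ a, (2 * (k : ℝ) + 2) * ((2 * k + 1) *
            (c ^ 2 * traceCLM E ((X f + u • v a) ^ (2 * k)))) := by
        refine Finset.sum_le_sum fun f _ => Finset.sum_le_sum fun a _ => ?_
        refine mul_le_mul_of_nonneg_left ?_ (by positivity)
        have := Finset.sum_le_card_nsmul (Finset.range (2 * k + 1))
          (fun i => traceCLM E (v a * (X f + u • v a) ^ i * v a * (X f + u • v a) ^ (2 * k - i)))
          (c ^ 2 * traceCLM E ((X f + u • v a) ^ (2 * k))) fun i hi => by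
            have := Finset.mem_range.mp hi
            exact traceCLM_mul_pow_mul_pow_le (isSymmetric_add_smul (hX f) (hv a) u) (hv a)
              (hvc a) (by omega)
        simpa using this
      refine hsum.trans ?_
      simp_rw [← Finset.mul_sum]
      have := mul_le_mul_of_nonneg_left (ih u hu)
        (show (0 : ℝ) ≤ (2 * k + 2) * (2 * k + 1) * c ^ 2 by positivity)
      refine le_trans (le_of_eq ?_) this
      ring

theorem sum_traceCLM_pow_le {m : ℕ} (v : Fin m → E →L[ℝ] E)
    (hv : ∀ a, (v a : E →ₗ[ℝ] E).IsSymmetric) (hv0 : ∑ a, v a = 0) {c : ℝ}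
    (hvc : ∀ a, ‖v a‖ ≤ c) : ∀ s k : ℕ,
    ∑ f : Fin s → Fin m, traceCLM E ((∑ i, v (f i)) ^ (2 * k)) ≤
      momentBound (Module.finrank ℝ E * (m : ℝ) ^ s) (s * c ^ 2 / 2) k := by
  intro s
  induction s with
  | zero =>
    intro k
    have h1 : traceCLM E (1 : E →L[ℝ] E) = Module.finrank ℝ E := LinearMap.trace_one ℝ E
    rcases Nat.eq_zero_or_pos k with rfl | hk
    · simp [momentBound, h1]
    · simp [momentBound, zero_pow hk.ne', zero_pow (mul_ne_zero two_ne_zero hk.ne')]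
  | succ s ih =>
    intro k
    have hX : ∀ f : Fin s → Fin m, ((∑ i, v (f i) : E →L[ℝ] E) : E →ₗ[ℝ] E).IsSymmetric := by
      intro f x y
      have : ∀ i, inner ℝ (v (f i) x) y = inner ℝ x (v (f i) y) := fun i => hv (f i) x y
      simp [sum_inner, inner_sum, this]
    have h := sum_traceCLM_pow_add_le (fun f : Fin s → Fin m => ∑ i, v (f i)) hX v hv hv0 hvc
      (by positivity) (by positivity) ih k 1 zero_le_one
    rw [sum_fin_succ_fun, Finset.sum_comm]
    simp only [Fin.sum_univ_succ, Fin.cons_zero, Fin.cons_succ]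
    simp only [one_smul, Fintype.card_fin] at h
    convert h using 1
    · refine Finset.sum_congr rfl fun f _ => Finset.sum_congr rfl fun a _ => ?_
      rw [add_comm]
    · unfold momentBound; push_cast; ring

/-- Bounding the norm by traces, the `cosh` series is summed moment by moment: the `(2k)!` cancels,
leaving the exponential series. The dimension enters once, as the trace of the identity. -/
theorem sum_cosh_mul_opNorm_sum_le [Nontrivial E] {m : ℕ} (v : Fin m → E →L[ℝ] E)
    (hv : ∀ a, (v a : E →ₗ[ℝ] E).IsSymmetric) (hv0 : ∑ a, v a = 0) {c : ℝ}
    (hvc : ∀ a, ‖v a‖ ≤ c) (s : ℕ) (t : ℝ) :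
    ∑ f : Fin s → Fin m, Real.cosh (t * ‖∑ i, v (f i)‖) ≤
      Module.finrank ℝ E * (m : ℝ) ^ s * Real.exp (s * (t * c) ^ 2 / 2) := by
  have h1 := hasSum_sum (s := (Finset.univ : Finset (Fin s → Fin m)))
    fun f _ => Real.hasSum_cosh (t * ‖∑ i, v (f i)‖)
  have h2 : HasSum (fun k : ℕ => (Module.finrank ℝ E * (m : ℝ) ^ s) *
      ((s * (t * c) ^ 2 / 2) ^ k / k.factorial))
      (Module.finrank ℝ E * (m : ℝ) ^ s * Real.exp (s * (t * c) ^ 2 / 2)) := by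
    refine HasSum.mul_left _ ?_
    rw [Real.exp_eq_exp_ℝ]
    exact NormedSpace.expSeries_div_hasSum_exp _
  refine hasSum_le (fun k => ?_) h1 h2
  have hX : ∀ f : Fin s → Fin m, ((∑ i, v (f i) : E →L[ℝ] E) : E →ₗ[ℝ] E).IsSymmetric := by
    intro f x y
    have : ∀ i, inner ℝ (v (f i) x) y = inner ℝ x (v (f i) y) := fun i => hv (f i) x y
    simp [sum_inner, inner_sum, this]
  have hk : (0 : ℝ) < (2 * k).factorial := by exact_mod_cast (2 * k).factorial_pos
  have htk : 0 ≤ t ^ (2 * k) := by rw [pow_mul]; positivity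
  calc ∑ f : Fin s → Fin m, (t * ‖∑ i, v (f i)‖) ^ (2 * k) / ((2 * k).factorial : ℝ)
      = t ^ (2 * k) / (2 * k).factorial * ∑ f : Fin s → Fin m, ‖∑ i, v (f i)‖ ^ (2 * k) := by
        rw [Finset.mul_sum]
        refine Finset.sum_congr rfl fun f _ => ?_
        rw [mul_pow]; ring
    _ ≤ t ^ (2 * k) / (2 * k).factorial *
          momentBound (Module.finrank ℝ E * (m : ℝ) ^ s) (s * c ^ 2 / 2) k := by
        gcongr
        exact (Finset.sum_le_sum fun f _ => norm_pow_le_traceCLM (hX f) k).trans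
          (sum_traceCLM_pow_le v hv hv0 hvc s k)
    _ = _ := by
        unfold momentBound
        rw [show s * (t * c) ^ 2 / 2 = t ^ 2 * (s * c ^ 2 / 2) by ring, mul_pow (t ^ 2), pow_mul]
        field_simp
end Operators

namespace OEFNewton

/-! ### Deviation bounds for batches -/

open Classical in
theorem sum_admissible_le (c : Sampling) {m : ℕ} {V : Type*} [AddCommGroup V]
    {φ : V → ℝ} (hφ : ∀ x d, 2 * φ x ≤ φ (x + d) + φ (x - d)) (v : Fin m → V) (s : ℕ) :
    (m : ℝ) ^ s * ∑ f : Fin s → Fin m with c.Admissible (List.ofFn f), φ (∑ i, v (f i)) ≤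
      (c.count m s : ℝ) * ∑ f : Fin s → Fin m, φ (∑ i, v (f i)) := by
  cases c with
  | withReplacement =>
    have h : (Finset.univ.filter fun f : Fin s → Fin m =>
        Sampling.withReplacement.Admissible (List.ofFn f)) = Finset.univ :=
      Finset.filter_true_of_mem fun _ _ => trivial
    rw [h]
    simp [Sampling.count]
  | withoutReplacement =>
    simpa only [Sampling.Admissible, Sampling.count, List.nodup_ofFn] using
      card_pow_mul_sum_injective_le hφ v s

open Classical in
/-- Markov's inequality for admissible batches. -/
theorem card_admissible_mul_le (c : Sampling) {m : ℕ} (hm : 0 < m) {V : Type*} [AddCommGroup V]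
    {φ : V → ℝ} (hφ : ∀ x d, 2 * φ x ≤ φ (x + d) + φ (x - d)) (hφ0 : ∀ x, 0 ≤ φ x)
    (v : Fin m → V) (s : ℕ) {K C : ℝ}
    (hK : ∑ f : Fin s → Fin m, φ (∑ i, v (f i)) ≤ (m : ℝ) ^ s * K)
    (bad : V → Prop) (hbad : ∀ y, bad y → C ≤ φ y) :
    ((Finset.univ.filter fun f : Fin s → Fin m =>
      c.Admissible (List.ofFn f) ∧ bad (∑ i, v (f i))).card : ℝ) * C ≤ c.count m s * K := by
  have h1 : ((Finset.univ.filter fun f : Fin s → Fin m =>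
      c.Admissible (List.ofFn f) ∧ bad (∑ i, v (f i))).card : ℝ) * C ≤
      ∑ f : Fin s → Fin m with c.Admissible (List.ofFn f), φ (∑ i, v (f i)) := by
    rw [← nsmul_eq_mul]
    refine (Finset.card_nsmul_le_sum _ (fun f : Fin s → Fin m => φ (∑ i, v (f i))) _ fun f hf =>
      hbad _ (Finset.mem_filter.mp hf).2.2).trans ?_
    refine Finset.sum_le_sum_of_subset_of_nonneg (fun f hf => ?_) fun f _ _ => hφ0 _
    simp only [Finset.mem_filter, Finset.mem_univ, true_and] at hf ⊢
    exact hf.1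
  have h2 := sum_admissible_le c hφ v s
  have h3 : (0 : ℝ) < (m : ℝ) ^ s := by positivity
  have h4 : (c.count m s : ℝ) * ∑ f : Fin s → Fin m, φ (∑ i, v (f i)) ≤
      c.count m s * ((m : ℝ) ^ s * K) := by gcongr
  refine le_of_mul_le_mul_left ?_ h3
  calc (m : ℝ) ^ s * _ ≤ (m : ℝ) ^ s * _ := mul_le_mul_of_nonneg_left h1 h3.le
    _ ≤ _ := h2.trans h4
    _ = _ := by ring

/-! ### Numerical bounds for the failure probabilities -/

/-- A bound on the probability that a gradient batch deviates too much. -/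
noncomputable def gradFail (δ : ℝ) : ℝ := if δ ≤ 3 / 10 then 17 / 20 * δ else δ ^ 2

theorem gradFail_nonneg {δ : ℝ} (h0 : 0 < δ) : 0 ≤ gradFail δ := by
  unfold gradFail; split_ifs <;> positivity

theorem gradFail_le_one {δ : ℝ} (h0 : 0 < δ) (h1 : δ < 1) : gradFail δ ≤ 1 := by
  unfold gradFail; split_ifs <;> nlinarith

/-- Both failures of an iteration fit into the single budget `δ`. In the first regime the saving
`3δ/20` pays for the Hessian's `δ²/2` exactly when `δ ≤ 3/10`. -/
theorem one_sub_le_mul {δ : ℝ} (h0 : 0 < δ) (h1 : δ < 1) :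
    1 - δ ≤ (1 - δ ^ 2 / 2) * (1 - gradFail δ) := by
  unfold gradFail
  split_ifs with h
  · nlinarith [mul_pos h0 h0, mul_pos (mul_pos h0 h0) h0]
  · have : (1 - δ ^ 2 / 2) * (1 - δ ^ 2) - (1 - δ) = δ / 2 * (1 - δ) ^ 2 * (2 + δ) := by ring
    have : 0 ≤ δ / 2 * (1 - δ) ^ 2 * (2 + δ) := by positivity
    linarith

/-- From `log (1/δ) ≥ 1 - δ` and `1 - δ ≤ 8 δ²`, the latter valid for `δ > 3/10`. It turns the
Chebyshev bound `1 / K²` into `δ²`. -/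
theorem inv_le_one_add_sqrt_log {δ : ℝ} (h0 : 3 / 10 < δ) (h1 : δ < 1) :
    δ⁻¹ ≤ 1 + √(8 * Real.log (1 / δ)) := by
  have hδ : 0 < δ := by linarith
  have hlog : 1 - δ ≤ Real.log (1 / δ) := by
    have := Real.one_sub_inv_le_log_of_pos (inv_pos.mpr hδ)
    rwa [inv_inv, ← one_div] at this
  have : δ⁻¹ - 1 ≤ √(8 * Real.log (1 / δ)) := by
    apply Real.le_sqrt_of_sq_le
    have e : (δ⁻¹ - 1) ^ 2 = (1 - δ) ^ 2 / δ ^ 2 := by field_simp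
    rw [e, div_le_iff₀ (by positivity)]
    have h2 : (1 - δ) ^ 2 ≤ 8 * (1 - δ) * δ ^ 2 := by
      have : (1 - δ) ≤ 8 * δ ^ 2 := by nlinarith
      nlinarith
    nlinarith [sq_nonneg δ]
  linarith

/-- Expanding the square gives `l` plus `(1 + 2 √(8l)) / 8`. As `l ≥ log (10/3) ≥ 6/5`, the surplus
is at least `0.89`, and `2 exp (-0.89) ≤ 17/20`. -/
theorem two_mul_exp_neg_le {δ : ℝ} (h0 : 0 < δ) (h1 : δ ≤ 3 / 10) :
    2 * Real.exp (-((1 + √(8 * Real.log (1 / δ))) ^ 2 / 8)) ≤ 17 / 20 * δ := by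
  set l := Real.log (1 / δ) with hl
  have hl6 : 6 / 5 ≤ l := by
    have h : Real.log (10 / 3) ≤ l := by
      refine Real.log_le_log (by norm_num) ?_
      rw [le_div_iff₀ h0]; linarith
    have h2 : 6 ≤ 5 * Real.log (10 / 3) := by
      have : (5 : ℝ) * Real.log (10 / 3) = Real.log ((10 / 3) ^ 5) := by
        rw [Real.log_pow]; norm_num
      rw [this, Real.le_log_iff_exp_le (by norm_num)]
      have e : Real.exp 6 = Real.exp 1 ^ 6 := by rw [← Real.exp_nat_mul]; norm_num
      rw [e]
      refine (pow_le_pow_left₀ (Real.exp_pos 1).le Real.exp_one_lt_d9.le 6).trans ?_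
      norm_num
    linarith
  have hs : (306 : ℝ) / 100 ≤ √(8 * l) := by
    apply Real.le_sqrt_of_sq_le; norm_num; linarith
  have hs2 : √(8 * l) ^ 2 = 8 * l := Real.sq_sqrt (by linarith)
  have he : 89 / 100 + l ≤ (1 + √(8 * l)) ^ 2 / 8 := by nlinarith
  have hexp : Real.exp (-l) = δ := by
    rw [hl, one_div, Real.log_inv, neg_neg, Real.exp_log h0]
  have h89 : 2 ≤ 17 / 20 * Real.exp (89 / 100) := by
    have e : Real.exp (89 / 100) = Real.exp (89 / 200) ^ 2 := by
      rw [← Real.exp_nat_mul]; norm_num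
    have := Real.quadratic_le_exp_of_nonneg (show (0 : ℝ) ≤ 89 / 200 by norm_num)
    rw [e]
    have := pow_le_pow_left₀ (by norm_num) this 2
    refine le_trans ?_ (mul_le_mul_of_nonneg_left this (by norm_num))
    norm_num
  calc 2 * Real.exp (-((1 + √(8 * l)) ^ 2 / 8)) ≤ 2 * Real.exp (-(89 / 100) + -l) := by
        gcongr; linarith
    _ = 2 * Real.exp (-(89 / 100)) * δ := by rw [Real.exp_add, hexp]; ring
    _ ≤ 17 / 20 * δ := by
        gcongr
        rw [Real.exp_neg, ← div_eq_mul_inv, div_le_iff₀ (Real.exp_pos _)]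
        exact h89

theorem half_exp_le_cosh {x y : ℝ} (h : y ≤ x) : Real.exp y / 2 ≤ Real.cosh x := by
  have h1 : Real.exp y ≤ Real.exp x := Real.exp_le_exp.mpr h
  rw [Real.cosh_eq]
  linarith [Real.exp_pos (-x)]

open Classical in
theorem card_gradient_batch_le (c : Sampling) {m : ℕ} (hm : 0 < m) {V : Type*}
    [NormedAddCommGroup V] [InnerProductSpace ℝ V] (v : Fin m → V) {M : V}
    (hM : ∑ i, v i = (m : ℝ) • M) {U : ℝ} (hU0 : 0 < U) (hU : ∀ i, ‖v i‖ ≤ U) {δ : ℝ}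
    (h0 : 0 < δ) (h1 : δ < 1) (s : ℕ) :
    ((Finset.univ.filter fun f : Fin s → Fin m => c.Admissible (List.ofFn f) ∧
      U * √s * (1 + √(8 * Real.log (1 / δ))) < ‖∑ i, (v (f i) - M)‖).card : ℝ) ≤
      gradFail δ * c.count m s := by
  rcases Nat.eq_zero_or_pos s with rfl | hs
  · simp [mul_nonneg (gradFail_nonneg h0)]
  set K := 1 + √(8 * Real.log (1 / δ)) with hK
  have hK1 : 1 ≤ K := by linarith [Real.sqrt_nonneg (8 * Real.log (1 / δ))]
  have hs' : (0 : ℝ) < s := by exact_mod_cast hs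
  have hss : √(s : ℝ) ^ 2 = s := Real.sq_sqrt hs'.le
  have hsp : 0 < √(s : ℝ) := Real.sqrt_pos.mpr hs'
  have hv0 := sum_sub_mean_eq_zero v hM
  have hcount : (0 : ℝ) ≤ c.count m s := by positivity
  unfold gradFail
  split_ifs with hδ
  · have hb : ∀ i, ‖v i - M‖ ≤ 2 * U := fun i =>
      (norm_sub_le _ _).trans (by linarith [hU i, norm_mean_le hm v hM hU])
    -- This `t` minimizes the exponent `s (2tU)² / 2 - t U √s K`, with minimum `-K² / 8`.
    have ht : 0 < K / (4 * √s * U) := by positivity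
    have h := card_admissible_mul_le c hm (two_mul_cosh_norm_le ht.le)
      (fun x => (Real.cosh_pos _).le) (fun i => v i - M) s
      (sum_cosh_mul_norm_sum_le _ hv0 (by positivity) hb s ht)
      (fun y => U * √s * K < ‖y‖) (C := Real.exp (K ^ 2 / 4) / 2) (fun y (hy : U * √s * K < ‖y‖) => by
        refine half_exp_le_cosh ?_
        rw [div_mul_eq_mul_div, le_div_iff₀ (by positivity)]
        nlinarith)
    have e : (s : ℝ) * (K / (4 * √s * U) * (2 * U)) ^ 2 / 2 = K ^ 2 / 8 := by
      rw [div_mul_eq_mul_div, div_pow, mul_pow (4 * √(s : ℝ)), mul_pow 4, hss]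
      field_simp
      norm_num
    rw [e] at h
    have e2 : Real.exp (K ^ 2 / 4) = Real.exp (K ^ 2 / 8) * Real.exp (K ^ 2 / 8) := by
      rw [← Real.exp_add]; congr 1; ring
    rw [e2] at h
    have hp := Real.exp_pos (K ^ 2 / 8)
    have h3 := two_mul_exp_neg_le h0 hδ
    rw [Real.exp_neg, ← div_eq_mul_inv, div_le_iff₀ hp] at h3
    refine le_of_mul_le_mul_right ?_ hp
    have h4 : ∀ N : ℝ, N * (Real.exp (K ^ 2 / 8) * Real.exp (K ^ 2 / 8) / 2) ≤
        c.count m s * Real.exp (K ^ 2 / 8) → N * Real.exp (K ^ 2 / 8) ≤ 2 * c.count m s := by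
      intro N hN
      refine le_of_mul_le_mul_right ?_ hp
      linarith
    refine (h4 _ h).trans ?_
    have := mul_le_mul_of_nonneg_right h3 hcount
    linarith
  -- For larger `δ` the second moment is enough: Chebyshev's inequality with variance at most `U²`
  -- per draw.
  · have h := card_admissible_mul_le c hm (φ := fun x : V => ‖x‖ ^ 2)
      (fun x d => by
        have := parallelogram_law_with_norm ℝ x d
        nlinarith [sq_nonneg ‖d‖])
      (fun x => by positivity) (fun i => v i - M) s (K := s * U ^ 2)
      (by simpa using sum_norm_sq_sum_le _ hv0 (sum_norm_sub_mean_sq_le v hM hU) s 0)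
      (fun y => U * √s * K < ‖y‖) (C := (U * √s * K) ^ 2)
      (fun y hy => pow_le_pow_left₀ (by positivity) hy.le 2)
    rw [mul_pow, mul_pow, hss] at h
    have hKδ : 1 ≤ δ * K := by
      have := mul_le_mul_of_nonneg_left (inv_le_one_add_sqrt_log (by linarith) h1) h0.le
      rwa [mul_inv_cancel₀ h0.ne'] at this
    have hKδ2 : 1 ≤ δ ^ 2 * K ^ 2 := by
      rw [← mul_pow]; exact one_le_pow₀ hKδ
    have hsU : 0 < (s : ℝ) * U ^ 2 := by positivity
    have h4 : ∀ N : ℝ, N * (U ^ 2 * s * K ^ 2) ≤ c.count m s * (s * U ^ 2) →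
        N ≤ δ ^ 2 * c.count m s := by
      intro N hN
      have h5 : N * K ^ 2 ≤ c.count m s := by
        refine le_of_mul_le_mul_right ?_ hsU
        linarith
      refine le_of_mul_le_mul_right ?_ (show 0 < K ^ 2 by positivity)
      nlinarith
    exact h4 _ h

open Classical in
theorem card_hessian_batch_le (c : Sampling) {m n : ℕ} (hm : 0 < m)
    (v : Fin m → Vec n →L[ℝ] Vec n) (hv : ∀ i, (v i : Vec n →ₗ[ℝ] Vec n).IsSymmetric)
    {M : Vec n →L[ℝ] Vec n} (hM : ∑ i, v i = (m : ℝ) • M) {U : ℝ} (hU0 : 0 < U)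
    (hU : ∀ i, ‖v i‖ ≤ U) {δ : ℝ} (h0 : 0 < δ) (h1 : δ < 1) (s : ℕ) :
    ((Finset.univ.filter fun f : Fin s → Fin m => c.Admissible (List.ofFn f) ∧
      4 * U * √s * √(Real.log (2 * n / δ)) < ‖∑ i, (v (f i) - M)‖).card : ℝ) ≤
      δ ^ 2 / 2 * c.count m s := by
  have hcount : (0 : ℝ) ≤ c.count m s := by positivity
  rcases Nat.eq_zero_or_pos s with rfl | hs
  · simp only [Finset.univ_eq_empty, Finset.sum_empty, norm_zero, Nat.cast_zero, Real.sqrt_zero,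
      mul_zero, zero_mul, lt_irrefl, and_false, Finset.filter_false, Finset.card_empty]
    positivity
  rcases Nat.eq_zero_or_pos n with rfl | hn
  · have : ∀ f : Fin s → Fin m, ‖∑ i, (v (f i) - M)‖ = 0 := fun f => by
      rw [Subsingleton.elim (∑ i, (v (f i) - M)) 0, norm_zero]
    simp only [this]
    rw [Finset.filter_false_of_mem]
    · simp; positivity
    · rintro f - ⟨-, h⟩
      exact absurd h (not_lt.mpr (by positivity))
  have : Nontrivial (Vec n) := by
    have : Nonempty (Fin n) := ⟨⟨0, hn⟩⟩
    infer_instance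
  have hn' : (1 : ℝ) ≤ n := by exact_mod_cast hn
  set L := Real.log (2 * n / δ) with hL
  have hL0 : 0 < L := by
    refine Real.log_pos ?_
    rw [lt_div_iff₀ h0]; linarith
  have hs' : (0 : ℝ) < s := by exact_mod_cast hs
  have hss : √(s : ℝ) ^ 2 = s := Real.sq_sqrt hs'.le
  have hsp : 0 < √(s : ℝ) := Real.sqrt_pos.mpr hs'
  have hLL : √L ^ 2 = L := Real.sq_sqrt hL0.le
  have hLp : 0 < √L := Real.sqrt_pos.mpr hL0
  have hv0 := sum_sub_mean_eq_zero v hM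
  have hb : ∀ i, ‖v i - M‖ ≤ 2 * U := fun i =>
    (norm_sub_le _ _).trans (by linarith [hU i, norm_mean_le hm v hM hU])
  have hMsymm : (M : Vec n →ₗ[ℝ] Vec n).IsSymmetric := by
    intro x y
    have hm' : (m : ℝ) ≠ 0 := by positivity
    refine mul_left_cancel₀ hm' ?_
    have e : ∀ x, (m : ℝ) • M x = ∑ i, v i x := fun x => by
      have := congrArg (fun A : Vec n →L[ℝ] Vec n => A x) hM
      simpa using this.symm
    have h2 : inner ℝ ((m : ℝ) • M x) y = inner ℝ x ((m : ℝ) • M y) := by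
      rw [e, e, sum_inner, inner_sum]
      exact Finset.sum_congr rfl fun i _ => hv i x y
    simpa [inner_smul_left, inner_smul_right] using h2
  have hsymm : ∀ i, ((v i - M : Vec n →L[ℝ] Vec n) : Vec n →ₗ[ℝ] Vec n).IsSymmetric := by
    intro i
    have := isSymmetric_add_smul (hv i) hMsymm (-1)
    rwa [neg_one_smul, ← sub_eq_add_neg] at this
  -- The optimal `t` again: growth `exp (2L)` against threshold `exp (4L) / 2` leaves `2n exp (-2L)
  -- = δ² / (2n)`.
  have ht : 0 < √L / (√s * U) := by positivity
  have hsum := sum_cosh_mul_opNorm_sum_le _ hsymm hv0 hb s (√L / (√s * U))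
  have e : (s : ℝ) * (√L / (√s * U) * (2 * U)) ^ 2 / 2 = 2 * L := by
    rw [div_mul_eq_mul_div, div_pow, mul_pow √(s : ℝ), mul_pow √L, hss, hLL]
    field_simp
  rw [e, finrank_euclideanSpace_fin] at hsum
  have h := card_admissible_mul_le c hm (two_mul_cosh_norm_le ht.le)
    (fun x => (Real.cosh_pos _).le) (fun i => v i - M) s (K := n * Real.exp (2 * L))
    (hsum.trans_eq (by ring))
    (fun y => 4 * U * √s * √L < ‖y‖) (C := Real.exp (4 * L) / 2) (fun y hy => by
      refine half_exp_le_cosh ?_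
      rw [div_mul_eq_mul_div, le_div_iff₀ (by positivity)]
      have h5 : 4 * L * (√s * U) = √L * (4 * U * √s * √L) := by
        linear_combination (-4 * √s * U) * hLL
      rw [h5]
      gcongr)
  have e2 : Real.exp (4 * L) = Real.exp (2 * L) * Real.exp (2 * L) := by
    rw [← Real.exp_add]; congr 1; ring
  have e3 : Real.exp (2 * L) = (2 * n / δ) ^ 2 := by
    rw [two_mul, Real.exp_add, ← sq, hL, Real.exp_log (by positivity)]
  have hp := Real.exp_pos (2 * L)
  rw [e2] at h
  have h4 : ∀ N : ℝ, N * (Real.exp (2 * L) * Real.exp (2 * L) / 2) ≤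
      c.count m s * (n * Real.exp (2 * L)) → N ≤ δ ^ 2 / 2 * c.count m s := by
    intro N hN
    have h5 : N * Real.exp (2 * L) ≤ c.count m s * (2 * n) := by
      refine le_of_mul_le_mul_right ?_ hp
      linarith
    rw [e3] at h5
    refine le_of_mul_le_mul_right ?_ (show 0 < (2 * n / δ : ℝ) ^ 2 by positivity)
    refine h5.trans ?_
    have e6 : δ ^ 2 / 2 * c.count m s * (2 * n / δ) ^ 2 = c.count m s * (2 * n * n) := by
      field_simp
    rw [e6]
    gcongr
    nlinarith
  exact h4 _ h

/-! ### Conditional probability of a bad batch -/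

theorem Sampling.Admissible.count_pos {c : Sampling} {m : ℕ} {l : List (Fin m)}
    (h : c.Admissible l) : 0 < c.count m l.length := by
  cases c with
  | withReplacement =>
    cases l with
    | nil => simp [Sampling.count]
    | cons a l => exact pow_pos a.pos _
  | withoutReplacement =>
    refine Nat.descFactorial_pos.mpr ?_
    simpa using List.Nodup.length_le_card (show l.Nodup from h)

open Classical in
-- Since `A ∩ B l` belongs to `𝒜`, uniformity applies to it for each list `l`. Summing over `l` and
-- exchanging sum and integral leaves the pointwise number of bad lists, which is at most `p` times
-- the count.
theorem measure_inter_bad_batch_length_le {Ω : Type*} {𝒜 mΩ : MeasurableSpace Ω}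
    {P : Measure Ω} [IsFiniteMeasure P] {c : Sampling} {m : ℕ}
    (h𝒜 : 𝒜 ≤ mΩ) {S : Ω → List (Fin m)} (hS : IsUniformBatch P c 𝒜 S)
    (B : List (Fin m) → Set Ω) (hB : ∀ l, MeasurableSet[𝒜] (B l)) {p : ℝ} (hp : 0 ≤ p)
    (hcount : ∀ (ω : Ω) (s : ℕ), ((Finset.univ.filter fun f : Fin s → Fin m =>
      c.Admissible (List.ofFn f) ∧ ω ∈ B (List.ofFn f)).card : ℝ) ≤ p * c.count m s)
    {A : Set Ω} (hA : MeasurableSet[𝒜] A) (s : ℕ) :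
    P (A ∩ {ω | ω ∈ B (S ω)} ∩ {ω | (S ω).length = s}) ≤
      ENNReal.ofReal p * P (A ∩ {ω | (S ω).length = s}) := by
  set T := A ∩ {ω | (S ω).length = s} with hT
  have hTm : MeasurableSet T := h𝒜 _ (hA.inter (hS.size_known s))
  set adm := (Finset.univ.filter fun f : Fin s → Fin m => c.Admissible (List.ofFn f)) with hadm
  have hsub : A ∩ {ω | ω ∈ B (S ω)} ∩ {ω | (S ω).length = s} ⊆
      ⋃ f ∈ adm, (A ∩ B (List.ofFn f)) ∩ {ω | S ω = List.ofFn f} := by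
    rintro ω ⟨⟨h1, h2⟩, h3⟩
    simp only [Set.mem_ofPred_eq] at h2 h3
    subst h3
    have h4 : List.ofFn (S ω).get = S ω := List.ofFn_get _
    refine Set.mem_biUnion (x := (S ω).get) ?_ ⟨⟨h1, ?_⟩, h4.symm⟩
    · simp only [hadm, Finset.coe_filter, Finset.mem_univ, true_and, Set.mem_ofPred_eq]
      rw [h4]; exact hS.admissible ω
    · rw [h4]; exact h2
  by_cases hc : c.count m s = 0
  · have hempty : A ∩ {ω | ω ∈ B (S ω)} ∩ {ω | (S ω).length = s} = ∅ := by
      rw [Set.eq_empty_iff_forall_notMem]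
      rintro ω ⟨-, h3⟩
      have h4 := (hS.admissible ω).count_pos
      rw [show (S ω).length = s from h3] at h4
      exact h4.ne' hc
    rw [hempty]; simp
  have hterm : ∀ f ∈ adm, P ((A ∩ B (List.ofFn f)) ∩ {ω | S ω = List.ofFn f}) *
      (c.count m s : ENNReal) = P (T ∩ B (List.ofFn f)) := by
    intro f hf
    have := hS.uniform (A ∩ B (List.ofFn f)) (hA.inter (hB _)) (List.ofFn f)
      (Finset.mem_filter.mp hf).2
    rw [List.length_ofFn] at this
    rw [this, hT]
    congr 1
    ext ω; simp only [Set.mem_inter_iff]; tauto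
  have hsum : ∑ f ∈ adm, P (T ∩ B (List.ofFn f)) ≤
      ENNReal.ofReal p * c.count m s * P T := by
    calc ∑ f ∈ adm, P (T ∩ B (List.ofFn f))
        = ∑ f ∈ adm, ∫⁻ ω in T, (B (List.ofFn f)).indicator 1 ω ∂P := by
          refine Finset.sum_congr rfl fun f _ => ?_
          rw [lintegral_indicator_one (h𝒜 _ (hB _)),
            Measure.restrict_apply (h𝒜 _ (hB _)), Set.inter_comm]
      _ = ∫⁻ ω in T, ∑ f ∈ adm, (B (List.ofFn f)).indicator 1 ω ∂P := by
          rw [lintegral_finsetSum]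
          exact fun f _ => measurable_one.indicator (h𝒜 _ (hB _))
      _ ≤ ∫⁻ _ in T, ENNReal.ofReal p * c.count m s ∂P := by
          refine lintegral_mono fun ω => ?_
          have e : ∑ f ∈ adm, (B (List.ofFn f)).indicator (1 : Ω → ENNReal) ω =
              ((Finset.univ.filter fun f : Fin s → Fin m =>
                c.Admissible (List.ofFn f) ∧ ω ∈ B (List.ofFn f)).card : ENNReal) := by
            rw [← Finset.filter_filter, Finset.card_filter]
            push_cast
            refine Finset.sum_congr rfl fun f _ => ?_
            simp [Set.indicator_apply]
          rw [e, ← ENNReal.ofReal_natCast, ← ENNReal.ofReal_natCast, ← ENNReal.ofReal_mul hp]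
          exact ENNReal.ofReal_le_ofReal (hcount ω s)
      _ = _ := by simp
  have hc' : (c.count m s : ENNReal) ≠ 0 := by exact_mod_cast hc
  have hct : (c.count m s : ENNReal) ≠ ⊤ := ENNReal.natCast_ne_top _
  refine (ENNReal.mul_le_mul_iff_left hc' hct).mp ?_
  calc P (A ∩ {ω | ω ∈ B (S ω)} ∩ {ω | (S ω).length = s}) * c.count m s
      ≤ (∑ f ∈ adm, P ((A ∩ B (List.ofFn f)) ∩ {ω | S ω = List.ofFn f})) * c.count m s := by
        gcongr
        exact (measure_mono hsub).trans (measure_biUnion_finset_le _ _)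
    _ = ∑ f ∈ adm, P (T ∩ B (List.ofFn f)) := by
        rw [Finset.sum_mul]; exact Finset.sum_congr rfl hterm
    _ ≤ _ := hsum.trans_eq (by ring)

/-- If, whatever the past, at most a fraction `p` of the admissible batches of each size is bad,
then the batch that is drawn is bad with probability at most `p`. -/
theorem measure_inter_bad_batch_le {Ω : Type*} {𝒜 mΩ : MeasurableSpace Ω}
    {P : Measure Ω} [IsFiniteMeasure P] {c : Sampling} {m : ℕ}
    (h𝒜 : 𝒜 ≤ mΩ) {S : Ω → List (Fin m)} (hS : IsUniformBatch P c 𝒜 S)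
    (B : List (Fin m) → Set Ω) (hB : ∀ l, MeasurableSet[𝒜] (B l)) {p : ℝ} (hp : 0 ≤ p)
    (hcount : ∀ (ω : Ω) (s : ℕ), (open Classical in (Finset.univ.filter fun f : Fin s → Fin m =>
      c.Admissible (List.ofFn f) ∧ ω ∈ B (List.ofFn f)).card : ℝ) ≤ p * c.count m s)
    {A : Set Ω} (hA : MeasurableSet[𝒜] A) :
    P (A ∩ {ω | ω ∈ B (S ω)}) ≤ ENNReal.ofReal p * P A := by
  have hcover : ∀ C : Set Ω, C = ⋃ s : ℕ, C ∩ {ω | (S ω).length = s} := fun C => by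
    ext ω; simp
  have hdisj : P A = ∑' s : ℕ, P (A ∩ {ω | (S ω).length = s}) := by
    conv_lhs => rw [hcover A]
    refine measure_iUnion (fun i j hij => ?_) fun s => h𝒜 _ (hA.inter (hS.size_known s))
    refine Set.disjoint_left.mpr ?_
    rintro ω ⟨-, h1⟩ ⟨-, h2⟩
    exact hij (h1.symm.trans h2)
  calc P (A ∩ {ω | ω ∈ B (S ω)})
      ≤ ∑' s : ℕ, P (A ∩ {ω | ω ∈ B (S ω)} ∩ {ω | (S ω).length = s}) := by
        conv_lhs => rw [hcover (A ∩ {ω | ω ∈ B (S ω)})]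
        exact measure_iUnion_le _
    _ ≤ ∑' s : ℕ, ENNReal.ofReal p * P (A ∩ {ω | (S ω).length = s}) :=
        ENNReal.tsum_le_tsum fun s =>
          measure_inter_bad_batch_length_le h𝒜 hS B hB hp hcount hA s
    _ = _ := by rw [ENNReal.tsum_mul_left, ← hdisj]

theorem le_measure_inter_good_batch {Ω : Type*} {𝒜 mΩ : MeasurableSpace Ω}
    {P : Measure Ω} [IsFiniteMeasure P] {c : Sampling} {m : ℕ}
    (h𝒜 : 𝒜 ≤ mΩ) {S : Ω → List (Fin m)} (hS : IsUniformBatch P c 𝒜 S)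
    (B : List (Fin m) → Set Ω) (hB : ∀ l, MeasurableSet[𝒜] (B l)) {p : ℝ} (hp : 0 ≤ p)
    (hcount : ∀ (ω : Ω) (s : ℕ), (open Classical in (Finset.univ.filter fun f : Fin s → Fin m =>
      c.Admissible (List.ofFn f) ∧ ω ∈ B (List.ofFn f)).card : ℝ) ≤ p * c.count m s)
    {A : Set Ω} (hA : MeasurableSet[𝒜] A) :
    ENNReal.ofReal (1 - p) * P A ≤ P (A ∩ {ω | ω ∉ B (S ω)}) := by
  have h1 := measure_inter_bad_batch_le h𝒜 hS B hB hp hcount hA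
  have h2 : P A ≤ P (A ∩ {ω | ω ∈ B (S ω)}) + P (A ∩ {ω | ω ∉ B (S ω)}) := by
    refine (measure_mono fun ω hω => ?_).trans (measure_union_le _ _)
    by_cases h : ω ∈ B (S ω)
    · exact Or.inl ⟨hω, h⟩
    · exact Or.inr ⟨hω, h⟩
  rw [ENNReal.ofReal_sub _ hp, ENNReal.ofReal_one,
    ENNReal.sub_mul (fun _ _ => measure_ne_top P A), one_mul]
  refine tsub_le_iff_left.mpr (h2.trans ?_)
  gcongr

theorem measurableSet_mem_batch {Ω : Type*} {𝒜 : MeasurableSpace Ω} {m : ℕ}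
    {S : Ω → List (Fin m)} (hS : ∀ l, MeasurableSet[𝒜] {ω | S ω = l})
    (B : List (Fin m) → Set Ω) (hB : ∀ l, MeasurableSet[𝒜] (B l)) :
    MeasurableSet[𝒜] {ω | ω ∈ B (S ω)} := by
  have : {ω | ω ∈ B (S ω)} = ⋃ l, {ω | S ω = l} ∩ B l := by
    ext ω; simp
  rw [this]
  exact MeasurableSet.iUnion fun l => (hS l).inter (hB l)

/-! ### Calculus near the minimizer -/

theorem inner_gradient_le_of_strongConvexOn {n : ℕ} {f : Vec n → ℝ} {D : Set (Vec n)} {σ : ℝ}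
    (hf : StrongConvexOn D σ f) {x y : Vec n} (hx : x ∈ D) (hy : y ∈ D)
    (hd : DifferentiableAt ℝ f x) :
    inner ℝ (gradient f x) (y - x) ≤ f y - f x - σ / 2 * ‖y - x‖ ^ 2 := by
  rw [inner_gradient_left]
  have h1 := (hd.hasFDerivAt.hasLineDerivAt (y - x)).tendsto_slope_zero_right
  have h2 : Filter.Tendsto (fun t : ℝ => f y - f x - σ / 2 * (1 - t) * ‖y - x‖ ^ 2)
      (nhdsWithin 0 (Set.Ioi 0)) (nhds (f y - f x - σ / 2 * ‖y - x‖ ^ 2)) := by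
    have : Continuous fun t : ℝ => f y - f x - σ / 2 * (1 - t) * ‖y - x‖ ^ 2 := by fun_prop
    have h := (this.tendsto 0).mono_left (nhdsWithin_le_nhds (s := Set.Ioi 0))
    simpa using h
  refine le_of_tendsto_of_tendsto h1 h2 ?_
  have h3 : Set.Ioo (0 : ℝ) 1 ∈ nhdsWithin (0 : ℝ) (Set.Ioi 0) := Ioo_mem_nhdsGT zero_lt_one
  filter_upwards [h3] with t ht
  have h4 := hf.2 hx hy (sub_nonneg.mpr ht.2.le) ht.1.le (by ring)
  have e : (1 - t) • x + t • y = x + t • (y - x) := by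
    rw [smul_sub, sub_smul, one_smul]; abel
  rw [e] at h4
  simp only [smul_eq_mul] at h4 ⊢
  rw [inv_mul_le_iff₀ ht.1]
  rw [norm_sub_rev x y] at h4
  nlinarith

theorem inner_gradient_sub_ge {n : ℕ} {f : Vec n → ℝ} {D : Set (Vec n)} {σ : ℝ}
    (hf : StrongConvexOn D σ f) {x y : Vec n} (hx : x ∈ D) (hy : y ∈ D)
    (hdx : DifferentiableAt ℝ f x) (hdy : DifferentiableAt ℝ f y) :
    σ * ‖y - x‖ ^ 2 ≤ inner ℝ (gradient f y - gradient f x) (y - x) := by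
  have h1 := inner_gradient_le_of_strongConvexOn hf hx hy hdx
  have h2 := inner_gradient_le_of_strongConvexOn hf hy hx hdy
  rw [norm_sub_rev x y, ← neg_sub y x, inner_neg_right] at h2
  rw [inner_sub_left]
  linarith

theorem norm_gradient_sub_ge {n : ℕ} {f : Vec n → ℝ} {D : Set (Vec n)} {σ : ℝ}
    (hf : StrongConvexOn D σ f) {x y : Vec n} (hx : x ∈ D) (hy : y ∈ D)
    (hdx : DifferentiableAt ℝ f x) (hdy : DifferentiableAt ℝ f y) :
    σ * ‖y - x‖ ≤ ‖gradient f y - gradient f x‖ := by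
  rcases (norm_nonneg (y - x)).eq_or_lt with h | h
  · rw [← h, mul_zero]; exact norm_nonneg _
  · refine le_of_mul_le_mul_right ?_ h
    have := (inner_gradient_sub_ge hf hx hy hdx hdy).trans (real_inner_le_norm _ _)
    linarith

theorem inner_hessian_ge {n : ℕ} {f : Vec n → ℝ} {D O : Set (Vec n)} {σ : ℝ}
    (hf : StrongConvexOn D σ f) (hO : IsOpen O) (hOD : O ⊆ D) (hd : DifferentiableOn ℝ f O)
    {x : Vec n} (hx : x ∈ O) (hg : DifferentiableAt ℝ (gradient f) x) (d : Vec n) :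
    σ * ‖d‖ ^ 2 ≤ inner ℝ (hessian f x d) d := by
  have h1 := (hg.hasFDerivAt.hasLineDerivAt d).tendsto_slope_zero_right
  have h2 := h1.inner (𝕜 := ℝ) (tendsto_const_nhds (x := d))
  refine ge_of_tendsto h2 ?_
  have h3 : ∀ᶠ t : ℝ in nhdsWithin 0 (Set.Ioi 0), x + t • d ∈ O := by
    have hc : Continuous fun t : ℝ => x + t • d := by fun_prop
    exact nhdsWithin_le_nhds (hc.continuousAt.eventually_mem (hO.mem_nhds (by simpa using hx)))
  filter_upwards [h3, self_mem_nhdsWithin] with t ht ht0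
  have ht0' : (0 : ℝ) < t := ht0
  have h4 := inner_gradient_sub_ge hf (hOD hx) (hOD ht) (hd.differentiableAt (hO.mem_nhds hx))
    (hd.differentiableAt (hO.mem_nhds ht))
  rw [add_sub_cancel_left, inner_smul_right, norm_smul, Real.norm_of_nonneg ht0'.le] at h4
  rw [real_inner_smul_left, ← div_eq_inv_mul, le_div_iff₀ ht0']
  refine le_of_mul_le_mul_left ?_ ht0'
  linarith

theorem gradient_eq_zero_of_isMinOn {n : ℕ} {f : Vec n → ℝ} {D : Set (Vec n)} {xs : Vec n}
    (hmin : IsMinOn f D xs) (hD : D ∈ nhds xs) : gradient f xs = 0 := by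
  rw [gradient, (hmin.isLocalMin hD).fderiv_eq_zero, map_zero]

/-- The mean value inequality on the ball of radius `‖d‖` suffices. It gives `Lh` instead of the
sharp `Lh / 2`; the slack in the step length absorbs the factor. -/
theorem norm_gradient_taylor_le {n : ℕ} {f : Vec n → ℝ} {O : Set (Vec n)} {Lh : NNReal}
    (hO : IsOpen O) (hOc : Convex ℝ O) (hg : DifferentiableOn ℝ (gradient f) O)
    (hLh : LipschitzOnWith Lh (hessian f) O) {x d : Vec n} (hx : x ∈ O) (hxd : x + d ∈ O) :
    ‖gradient f (x + d) - gradient f x - hessian f x d‖ ≤ Lh * ‖d‖ ^ 2 := by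
  have hmem : x ∈ O ∩ Metric.closedBall x ‖d‖ := ⟨hx, by simp⟩
  have hmem' : x + d ∈ O ∩ Metric.closedBall x ‖d‖ := ⟨hxd, by simp⟩
  have h := (hOc.inter (convex_closedBall x ‖d‖)).norm_image_sub_le_of_norm_fderiv_le' (𝕜 := ℝ)
    (f := gradient f) (φ := hessian f x) (C := Lh * ‖d‖)
    (fun y hy => hg.differentiableAt (hO.mem_nhds hy.1))
    (fun y hy => by
      refine (hLh.norm_sub_le hy.1 hx).trans ?_
      gcongr
      simpa [dist_eq_norm] using hy.2) hmem hmem'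
  rw [add_sub_cancel_left] at h
  linarith

/-! ### Derivatives of the finite sum -/

section FiniteSum
variable {n m : ℕ} {F : Fin m → Vec n → ℝ} {O : Set (Vec n)}

theorem hasGradientAt_finiteSum (hO : IsOpen O) (hF : ∀ i, DifferentiableOn ℝ (F i) O)
    {x : Vec n} (hx : x ∈ O) :
    HasGradientAt (finiteSum F) ((1 / (m : ℝ)) • ∑ i, gradient (F i) x) x := by
  rw [hasGradientAt_iff_hasFDerivAt]
  have h : HasFDerivAt (fun y => ∑ i, F i y) (∑ i, fderiv ℝ (F i) x) x :=
    HasFDerivAt.fun_sum fun i _ => ((hF i).differentiableAt (hO.mem_nhds hx)).hasFDerivAt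
  refine (h.const_mul (1 / (m : ℝ))).congr_fderiv ?_
  simp [gradient]

theorem hasFDerivAt_gradient_finiteSum (hO : IsOpen O) (hF : ∀ i, DifferentiableOn ℝ (F i) O)
    (hF' : ∀ i, DifferentiableOn ℝ (gradient (F i)) O) {x : Vec n} (hx : x ∈ O) :
    HasFDerivAt (gradient (finiteSum F)) ((1 / (m : ℝ)) • ∑ i, hessian (F i) x) x := by
  have h : HasFDerivAt (fun y => ∑ i, gradient (F i) y) (∑ i, hessian (F i) x) x :=
    HasFDerivAt.fun_sum fun i _ => ((hF' i).differentiableAt (hO.mem_nhds hx)).hasFDerivAt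
  refine (h.const_smul (1 / (m : ℝ))).congr_of_eventuallyEq ?_
  filter_upwards [hO.mem_nhds hx] with y hy
  exact (hasGradientAt_finiteSum hO hF hy).gradient

theorem sum_gradient_eq (hm : 0 < m) (hO : IsOpen O) (hF : ∀ i, DifferentiableOn ℝ (F i) O)
    {x : Vec n} (hx : x ∈ O) :
    ∑ i, gradient (F i) x = (m : ℝ) • gradient (finiteSum F) x := by
  have : (m : ℝ) ≠ 0 := by positivity
  rw [(hasGradientAt_finiteSum hO hF hx).gradient, smul_smul, mul_one_div_cancel this, one_smul]

theorem sum_hessian_eq (hm : 0 < m) (hO : IsOpen O) (hF : ∀ i, DifferentiableOn ℝ (F i) O)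
    (hF' : ∀ i, DifferentiableOn ℝ (gradient (F i)) O) {x : Vec n} (hx : x ∈ O) :
    ∑ i, hessian (F i) x = (m : ℝ) • hessian (finiteSum F) x := by
  have : (m : ℝ) ≠ 0 := by positivity
  rw [hessian, (hasFDerivAt_gradient_finiteSum hO hF hF' hx).fderiv, smul_smul,
    mul_one_div_cancel this, one_smul]

end FiniteSum

theorem hessian_isSymmetric {n : ℕ} {f : Vec n → ℝ} {O : Set (Vec n)} (hO : IsOpen O)
    (hf : DifferentiableOn ℝ f O) (hg : DifferentiableOn ℝ (gradient f) O) {x : Vec n}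
    (hx : x ∈ O) : (hessian f x : Vec n →ₗ[ℝ] Vec n).IsSymmetric := by
  intro u v
  have h1 : ∀ᶠ y in nhds x, HasFDerivAt f (fderiv ℝ f y) y := by
    filter_upwards [hO.mem_nhds hx] with y hy
    exact (hf.differentiableAt (hO.mem_nhds hy)).hasFDerivAt
  set Φ : Vec n →L[ℝ] StrongDual ℝ (Vec n) :=
    (isBoundedBilinearMap_inner (𝕜 := ℝ) (E := Vec n)).toContinuousLinearMap with hΦ
  have hΦ' : ∀ a b : Vec n, Φ a b = inner ℝ a b := fun a b => rfl
  have h2 : HasFDerivAt (fderiv ℝ f) (Φ.comp (hessian f x)) x := by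
    have e : fderiv ℝ f = fun y => Φ (gradient f y) := by
      funext y
      ext z
      rw [hΦ', inner_gradient_left]
    rw [e]
    exact Φ.hasFDerivAt.comp x (hg.differentiableAt (hO.mem_nhds hx)).hasFDerivAt
  have h3 := second_derivative_symmetric_of_eventually h1 h2 u v
  simp only [ContinuousLinearMap.comp_apply, hΦ'] at h3
  exact h3.trans (real_inner_comm _ _)

theorem measurable_gradient {n : ℕ} (f : Vec n → ℝ) : Measurable (gradient f) :=
  (InnerProductSpace.toDual ℝ (Vec n)).symm.continuous.measurable.comp (measurable_fderiv ℝ f)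

theorem measurable_hessian {n : ℕ} (f : Vec n → ℝ) : Measurable (hessian f) :=
  measurable_fderiv ℝ (gradient f)

/-! ### The local estimate for one step -/

theorem varsigma0_nonneg {σ Lg Lh ε0 δhBar : ℝ} (hLg : 0 ≤ Lg) (hLh : 0 ≤ Lh) (hε0 : 0 < ε0)
    (hδ : δhBar < σ) : 0 ≤ varsigma0 σ Lg Lh ε0 δhBar := by
  have : 0 < σ - δhBar := by linarith
  unfold varsigma0; positivity

theorem eps1_pos {σ Lg Lh ε0 δhBar : ℝ} (hLg : 0 ≤ Lg) (hLh : 0 ≤ Lh) (hε0 : 0 < ε0)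
    (hδ : δhBar < σ) : 0 < eps1 σ Lg Lh ε0 δhBar := by
  have := varsigma0_nonneg hLg hLh hε0 hδ
  unfold eps1; positivity

theorem varsigma1_nonneg {σ Lg Ug θ δgBar : ℝ} (hσ : 0 < σ) (hLg : 0 ≤ Lg) (hUg : 0 < Ug)
    (hδ : δgBar < 1) : 0 ≤ varsigma1 σ Lg Ug θ δgBar := by
  have : 0 < 1 - δgBar := by linarith
  unfold varsigma1; positivity

theorem varsigma2_nonneg {σ Lg Lh Ug ε0 θ δgBar δhBar : ℝ} (hσ : 0 < σ) (hLg : 0 ≤ Lg)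
    (hLh : 0 ≤ Lh) (hUg : 0 < Ug) (hε0 : 0 < ε0) (hδg0 : 0 ≤ δgBar) (hδg : δgBar < 1)
    (hδh : δhBar < σ) : 0 ≤ varsigma2 σ Lg Lh Ug ε0 θ δgBar δhBar := by
  have h0 := varsigma0_nonneg hLg hLh hε0 hδh
  have h1 := eps1_pos hLg hLh hε0 hδh
  have h2 := varsigma1_nonneg (θ := θ) hσ hLg hUg hδg
  have h3 : 0 < 1 - δgBar := by linarith
  unfold varsigma2; positivity

/-- The closed-form part of the estimate: here `G = ‖g‖`, `N = ‖d‖`, `e = ‖x - x*‖`, and `E` is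
the distance of the next iterate from `x*`. -/
theorem superlinear_bound {σ Lg Lh Ug ε0 θ δgBar δhBar δg δh G N e E : ℝ} (hσ : 0 < σ)
    (hLg : 0 ≤ Lg) (hLh : 0 ≤ Lh) (hUg : 0 < Ug) (hε0 : 0 < ε0) (hθ0 : 0 < θ) (hθ1 : θ ≤ 1)
    (hδgBar0 : 0 ≤ δgBar) (hδgBar1 : δgBar < 1) (hδhBar : δhBar < σ)
    (hG : 0 ≤ G) (hN : 0 ≤ N) (he : 0 < e) (heε : e ≤ eps1 σ Lg Lh ε0 δhBar)
    (hδg : δg ≤ δgBar) (hδgG : δg ≤ G ^ θ) (hδg2 : δg ≤ 1 / 2) (hδhG : δh ≤ G ^ θ)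
    (hNe : N ≤ 2 / 7 / (1 - δg) * (varsigma0 σ Lg Lh ε0 δhBar * e))
    (hGN : G ≤ (Lg + σ + Ug ^ θ / (2 * (1 - δgBar) ^ θ)) * N)
    (hE : σ * E ≤ Lh * N ^ 2 + δh * N + 1 / 2 * G ^ θ * N + δg * G) :
    E ≤ varsigma2 σ Lg Lh Ug ε0 θ δgBar δhBar * e ^ (1 + θ) := by
  have hδ1 : 0 < 1 - δgBar := by linarith
  have h0 := varsigma0_nonneg hLg hLh hε0 hδhBar
  have hε1 := eps1_pos hLg hLh hε0 hδhBar
  have hς1 := varsigma1_nonneg (θ := θ) hσ hLg hUg hδgBar1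
  set a := Lg + σ + Ug ^ θ / (2 * (1 - δgBar) ^ θ) with ha
  have ha0 : 0 < a := by positivity
  set s := varsigma0 σ Lg Lh ε0 δhBar with hs
  set ρ := 2 / 7 / (1 - δg) with hρ
  have h1δ : 0 < 1 - δg := by linarith
  have hρ0 : 0 < ρ := by positivity
  have hρ1 : ρ ≤ 4 / 7 := by rw [hρ, div_le_iff₀ h1δ]; linarith
  have hρ2 : ρ ≤ 2 / 7 / (1 - δgBar) := by rw [hρ]; gcongr
  have hse : 0 ≤ s * e := by positivity
  -- the Taylor remainder
  have hA : Lh * N ^ 2 ≤ Lh * s ^ 2 * eps1 σ Lg Lh ε0 δhBar ^ (1 - θ) / (2 * (1 - δgBar)) *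
      e ^ (1 + θ) := by
    -- `ρ ≤ 4/7` and `(4/7)² < 1/2`; this regains the factor lost in the Taylor estimate.
    have h1 : N ^ 2 ≤ 1 / 2 * (s * e) ^ 2 := by
      refine (pow_le_pow_left₀ hN hNe 2).trans ?_
      rw [mul_pow]
      gcongr
      nlinarith
    have h2 : e ^ 2 = e ^ (1 - θ) * e ^ (1 + θ) := by
      rw [← Real.rpow_add he, ← Real.rpow_natCast]; congr 1; push_cast; ring
    have h3 : e ^ (1 - θ) ≤ eps1 σ Lg Lh ε0 δhBar ^ (1 - θ) :=
      Real.rpow_le_rpow he.le heε (by linarith)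
    have h4 : (1 : ℝ) / 2 ≤ 1 / (2 * (1 - δgBar)) := by
      apply one_div_le_one_div_of_le <;> linarith
    calc Lh * N ^ 2 ≤ Lh * (1 / 2 * (s * e) ^ 2) := by gcongr
      _ = 1 / 2 * (Lh * s ^ 2 * e ^ (1 - θ) * e ^ (1 + θ)) := by rw [mul_pow, h2]; ring
      _ ≤ 1 / (2 * (1 - δgBar)) *
          (Lh * s ^ 2 * eps1 σ Lg Lh ε0 δhBar ^ (1 - θ) * e ^ (1 + θ)) := by gcongr
      _ = _ := by ring
  -- the inexactness
  have hB : δh * N + 1 / 2 * G ^ θ * N + δg * G ≤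
      varsigma1 σ Lg Ug θ δgBar * s ^ (1 + θ) * e ^ (1 + θ) := by
    have hGθ : G ^ θ ≤ a ^ θ * N ^ θ := by
      rw [← Real.mul_rpow ha0.le hN]
      exact Real.rpow_le_rpow hG hGN hθ0.le
    have h1 : δh * N + 1 / 2 * G ^ θ * N + δg * G ≤ G ^ θ * ((3 / 2 + a) * N) := by
      have e1 : δh * N ≤ G ^ θ * N := by gcongr
      have e2 : δg * G ≤ G ^ θ * (a * N) := by gcongr
      linarith
    have hN1 : N ^ θ * N = N ^ (1 + θ) := by
      rw [add_comm, Real.rpow_add_one' hN (by linarith)]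
    have hN2 : N ^ (1 + θ) ≤ ρ * (s * e) ^ (1 + θ) := by
      refine (Real.rpow_le_rpow hN hNe (by linarith)).trans ?_
      rw [Real.mul_rpow hρ0.le hse]
      gcongr
      have := Real.rpow_le_rpow_of_exponent_ge hρ0 (by linarith) (show (1 : ℝ) ≤ 1 + θ by linarith)
      rwa [Real.rpow_one] at this
    have h2 : (3 / 2 + a) * ρ ≤ 1 / (1 - δgBar) * (a + σ + 1 / 2) := by
      calc (3 / 2 + a) * ρ ≤ (3 / 2 + a) * (2 / 7 / (1 - δgBar)) := by gcongr
        _ = 1 / (1 - δgBar) * ((3 / 2 + a) * (2 / 7)) := by ring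
        _ ≤ _ := by gcongr; linarith
    calc δh * N + 1 / 2 * G ^ θ * N + δg * G ≤ G ^ θ * ((3 / 2 + a) * N) := h1
      _ ≤ a ^ θ * N ^ θ * ((3 / 2 + a) * N) := by gcongr
      _ = a ^ θ * (3 / 2 + a) * N ^ (1 + θ) := by rw [← hN1]; ring
      _ ≤ a ^ θ * (3 / 2 + a) * (ρ * (s * e) ^ (1 + θ)) := by gcongr
      _ = a ^ θ * ((3 / 2 + a) * ρ) * (s * e) ^ (1 + θ) := by ring
      _ ≤ a ^ θ * (1 / (1 - δgBar) * (a + σ + 1 / 2)) * (s * e) ^ (1 + θ) := by gcongr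
      _ = _ := by rw [Real.mul_rpow h0 he.le]; unfold varsigma1; ring
  have hC : E ≤ 1 / σ * (Lh * s ^ 2 * eps1 σ Lg Lh ε0 δhBar ^ (1 - θ) / (2 * (1 - δgBar)) +
      varsigma1 σ Lg Ug θ δgBar * s ^ (1 + θ)) * e ^ (1 + θ) := by
    rw [one_div, mul_assoc, ← div_eq_inv_mul, le_div_iff₀ hσ]
    linarith
  refine hC.trans ?_
  unfold varsigma2
  gcongr
  linarith

/-- The second entry of the minimum defining `ε₂` says `ς₂ e^θ ≤ 1/2`, so the superlinear bound also
halves the distance. -/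
theorem varsigma2_mul_rpow_le {σ Lg Lh Ug ε0 θ δgBar δhBar e : ℝ} (hσ : 0 < σ) (hLg : 0 ≤ Lg)
    (hLh : 0 ≤ Lh) (hUg : 0 < Ug) (hε0 : 0 < ε0) (hθ0 : 0 < θ) (hδg0 : 0 ≤ δgBar)
    (hδg : δgBar < 1) (hδh : δhBar < σ) (he : 0 ≤ e)
    (heε : e ≤ eps2 σ Lg Lh Ug ε0 θ δgBar δhBar) :
    varsigma2 σ Lg Lh Ug ε0 θ δgBar δhBar * e ^ (1 + θ) ≤ e / 2 := by
  have h2 := varsigma2_nonneg (θ := θ) hσ hLg hLh hUg hε0 hδg0 hδg hδh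
  unfold eps2 at heε
  set s := varsigma2 σ Lg Lh Ug ε0 θ δgBar δhBar
  rcases h2.eq_or_lt with h | h
  · rw [← h, zero_mul]; positivity
  · have h3 : e ≤ (2 * s) ^ (-1 / θ) := heε.trans (min_le_right _ _)
    have h4 : e ^ θ ≤ (2 * s)⁻¹ := by
      refine (Real.rpow_le_rpow he h3 hθ0.le).trans_eq ?_
      rw [← Real.rpow_mul (by positivity), div_mul_cancel₀ _ hθ0.ne', Real.rpow_neg_one]
    rw [Real.rpow_add' he (by linarith), Real.rpow_one]
    calc s * (e * e ^ θ) ≤ s * (e * (2 * s)⁻¹) := by gcongr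
      _ = e / 2 := by field_simp

theorem newton_step_le {n : ℕ} {f : Vec n → ℝ} {D : Set (Vec n)} {σ : ℝ} (hσ : 0 < σ)
    (hconv : StrongConvexOn D σ f) {xs : Vec n} (hmin : IsMinOn f D xs)
    {ε0 : ℝ} (hε0 : 0 < ε0) (hball : Metric.ball xs ε0 ⊆ D)
    (hf : DifferentiableOn ℝ f (Metric.ball xs ε0))
    (hf' : DifferentiableOn ℝ (gradient f) (Metric.ball xs ε0)) {Lg Lh : NNReal}
    (hLg : LipschitzOnWith Lg (gradient f) (Metric.ball xs ε0))
    (hLh : LipschitzOnWith Lh (hessian f) (Metric.ball xs ε0)) {Ug : ℝ} (hUg : 0 < Ug)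
    (hfg : ∀ y ∈ Metric.ball xs ε0, ‖gradient f y‖ ≤ Ug) {θ : ℝ} (hθ0 : 0 < θ) (hθ1 : θ ≤ 1)
    {δgBar δhBar : ℝ} (hδgBar0 : 0 ≤ δgBar) (hδgBar1 : δgBar < 1) (hδhBar : δhBar < σ)
    {x g d : Vec n} {Q : Vec n →L[ℝ] Vec n} {δg δh : ℝ} (hg : g ≠ 0)
    (hstep : IsNewtonStep σ Lg θ δgBar δhBar δg δh g d Q)
    (hxs : ‖x - xs‖ * (1 + varsigma0 σ Lg Lh ε0 δhBar) < ε0)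
    (hgx : ‖g - gradient f x‖ ≤ δg * ‖g‖) (hQ : ‖Q - hessian f x‖ ≤ δh) :
    ‖x + d - xs‖ ≤ varsigma2 σ Lg Lh Ug ε0 θ δgBar δhBar * ‖x - xs‖ ^ (1 + θ) := by
  obtain ⟨hδg0, hδgle, hδh0, hδhle, hres⟩ := hstep
  obtain ⟨hδg1, hδg2⟩ := le_min_iff.mp hδgle
  obtain ⟨hδg2, hδg3⟩ := le_min_iff.mp hδg2
  obtain ⟨hδh1, hδh2⟩ := le_min_iff.mp hδhle
  have hς0 := varsigma0_nonneg Lg.coe_nonneg Lh.coe_nonneg hε0 hδhBar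
  have hO : IsOpen (Metric.ball xs ε0) := Metric.isOpen_ball
  have hxsO : xs ∈ Metric.ball xs ε0 := Metric.mem_ball_self hε0
  have hxe : ‖x - xs‖ ≤ ‖x - xs‖ * (1 + varsigma0 σ Lg Lh ε0 δhBar) :=
    le_mul_of_one_le_right (norm_nonneg _) (by linarith)
  have hxO : x ∈ Metric.ball xs ε0 := by
    rw [mem_ball_iff_norm]; linarith
  have hgs : gradient f xs = 0 := gradient_eq_zero_of_isMinOn hmin
    (Filter.mem_of_superset (hO.mem_nhds hxsO) hball)
  have hG : 0 < ‖g‖ := norm_pos_iff.mpr hg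
  have hgrad : (1 - δg) * ‖g‖ ≤ ‖gradient f x‖ := by
    have := norm_sub_norm_le g (gradient f x)
    linarith
  have hlip : ‖gradient f x‖ ≤ Lg * ‖x - xs‖ := by
    have := hLg.norm_sub_le hxO hxsO
    rwa [hgs, sub_zero] at this
  have hmono : ∀ y ∈ Metric.ball xs ε0, σ * ‖y - xs‖ ≤ ‖gradient f y‖ := by
    intro y hy
    have := norm_gradient_sub_ge hconv (hball hxsO) (hball hy)
      (hf.differentiableAt (hO.mem_nhds hxsO)) (hf.differentiableAt (hO.mem_nhds hy))
    rwa [hgs, sub_zero] at this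
  have hδg1' : 0 < 1 - δg := by linarith
  have he : 0 < ‖x - xs‖ := by
    refine (norm_nonneg _).lt_of_ne' fun h => ?_
    rw [h, mul_zero] at hlip
    have := mul_pos hδg1' hG
    linarith
  -- Strong monotonicity and the Lipschitz bound are compared at `x ≠ x*`, which `g ≠ 0` guarantees.
  -- Then `(σ - δʰ) / (2 (Lg + δʰ)) ≤ 1/2`, hence `δᵍ ≤ 1/2`.
  have hσLg : σ ≤ Lg := le_of_mul_le_mul_right ((hmono x hxO).trans hlip) he
  have hδhσ : δh < σ := by linarith
  have hδghalf : δg ≤ 1 / 2 := by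
    refine hδg3.trans ?_
    rw [div_le_div_iff₀ (by positivity) two_pos]
    linarith
  have hGθ : 0 < ‖g‖ ^ θ := Real.rpow_pos_of_pos hG θ
  have hmu1 : mu σ θ δh g ≤ 1 := min_le_left _ _
  have hmu2 : mu σ θ δh g * ‖g‖ ^ θ ≤ (σ - δh) / 4 := by
    have : mu σ θ δh g ≤ (σ - δh) / (4 * ‖g‖ ^ θ) := min_le_right _ _
    rw [le_div_iff₀ (by positivity)] at this
    linarith
  have hres2 : ‖Q d + g‖ ≤ (σ - δh) / 8 * ‖d‖ := by
    refine hres.trans ?_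
    gcongr
    linarith
  have hres3 : ‖Q d + g‖ ≤ 1 / 2 * ‖g‖ ^ θ * ‖d‖ := by
    refine hres.trans ?_
    gcongr
  have hQd : ‖Q d - hessian f x d‖ ≤ δh * ‖d‖ :=
    ((Q - hessian f x).le_opNorm d).trans (by gcongr)
  have hQlow : (σ - δh) * ‖d‖ ≤ ‖Q d‖ := by
    rcases (norm_nonneg d).eq_or_lt with h | h
    · rw [← h, mul_zero]; exact norm_nonneg _
    · refine le_of_mul_le_mul_right ?_ h
      have h1 := inner_hessian_ge hconv hO hball hf hxO (hf'.differentiableAt (hO.mem_nhds hxO)) d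
      have h2 : inner ℝ (hessian f x d) d = inner ℝ (Q d) d - inner ℝ (Q d - hessian f x d) d := by
        rw [inner_sub_left]; ring
      have h3 := real_inner_le_norm (Q d) d
      have h4 := neg_le_of_abs_le (abs_real_inner_le_norm (Q d - hessian f x d) d)
      have h5 := mul_le_mul_of_nonneg_right hQd h.le
      nlinarith
  have hQup : ‖Q d‖ ≤ (Lg + δh) * ‖d‖ := by
    have h1 : ‖hessian f x‖ ≤ Lg := norm_fderiv_le_of_lipschitzOn ℝ (hO.mem_nhds hxO) hLg
    have h2 := (hessian f x).le_of_opNorm_le h1 d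
    have h3 := norm_sub_norm_le (Q d) (hessian f x d)
    linarith
  -- The second entry of `μ` keeps the residual below an eighth of the lower bound for `‖Q d‖`. The
  -- resulting `8/7` is the `4 * (2/7)` in `hNe`.
  have hNG : 7 / 8 * (σ - δh) * ‖d‖ ≤ ‖g‖ := by
    have := norm_sub_le (Q d + g) g
    rw [add_sub_cancel_right] at this
    linarith
  have hGN : ‖g‖ ≤ (Lg + σ + Ug ^ θ / (2 * (1 - δgBar) ^ θ)) * ‖d‖ := by
    have h1 := norm_sub_le (Q d + g) (Q d)
    rw [add_sub_cancel_left] at h1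
    have h2 : ‖g‖ ^ θ ≤ Ug ^ θ / (1 - δgBar) ^ θ := by
      rw [← Real.div_rpow hUg.le (by linarith)]
      refine Real.rpow_le_rpow hG.le ?_ hθ0.le
      rw [le_div_iff₀ (by linarith)]
      have : ‖g‖ * (1 - δgBar) ≤ ‖g‖ * (1 - δg) := by gcongr
      linarith [hfg x hxO]
    have h3 : 1 / 2 * ‖g‖ ^ θ * ‖d‖ ≤ Ug ^ θ / (2 * (1 - δgBar) ^ θ) * ‖d‖ := by
      gcongr
      rw [mul_comm 2, ← div_div]
      linarith
    have h4 : δh * ‖d‖ ≤ σ * ‖d‖ := by gcongr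
    linarith
  have hNe : ‖d‖ ≤ 2 / 7 / (1 - δg) * (varsigma0 σ Lg Lh ε0 δhBar * ‖x - xs‖) := by
    have h1 : 4 * (Lg : ℝ) / (σ - δhBar) ≤ varsigma0 σ Lg Lh ε0 δhBar := by
      unfold varsigma0
      have : 0 ≤ (Lh : ℝ) * ε0 := by positivity
      exact div_le_div_of_nonneg_right (by linarith) (by linarith)
    refine le_trans ?_ (mul_le_mul_of_nonneg_left
      (mul_le_mul_of_nonneg_right h1 he.le) (by positivity))
    have hσδ : 0 < σ - δhBar := by linarith
    rw [div_div, div_mul_eq_mul_div, div_mul_eq_mul_div, mul_div_assoc', div_div,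
      le_div_iff₀ (by positivity)]
    have h2 : 7 / 8 * (σ - δhBar) * ‖d‖ ≤ ‖g‖ := by
      refine le_trans ?_ hNG
      gcongr
    have h3 := mul_le_mul_of_nonneg_left h2 hδg1'.le
    linarith
  have hNe' : ‖d‖ ≤ varsigma0 σ Lg Lh ε0 δhBar * ‖x - xs‖ := by
    refine hNe.trans (mul_le_of_le_one_left (by positivity) ?_)
    rw [div_le_one hδg1']; linarith
  have hxdO : x + d ∈ Metric.ball xs ε0 := by
    rw [mem_ball_iff_norm]
    have : ‖x + d - xs‖ ≤ ‖x - xs‖ + ‖d‖ := by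
      rw [add_sub_right_comm]; exact norm_add_le _ _
    linarith
  refine superlinear_bound hσ Lg.coe_nonneg Lh.coe_nonneg hUg hε0 hθ0 hθ1 hδgBar0 hδgBar1 hδhBar
    hG.le (norm_nonneg d) he ?_ hδg1 hδg2 hδghalf hδh2 hNe hGN ?_
  · unfold eps1
    rw [le_div_iff₀ (by linarith)]
    exact hxs.le
  · refine (hmono _ hxdO).trans ?_
    have h1 := norm_gradient_taylor_le hO (convex_ball xs ε0) hf' hLh hxO hxdO
    have e : gradient f (x + d) = (gradient f (x + d) - gradient f x - hessian f x d) -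
        (Q d - hessian f x d) + (Q d + g) - (g - gradient f x) := by abel
    rw [e]
    have h2 := norm_sub_le ((gradient f (x + d) - gradient f x - hessian f x d) -
        (Q d - hessian f x d) + (Q d + g)) (g - gradient f x)
    have h3 := norm_add_le ((gradient f (x + d) - gradient f x - hessian f x d) -
        (Q d - hessian f x d)) (Q d + g)
    have h4 := norm_sub_le (gradient f (x + d) - gradient f x - hessian f x d)
        (Q d - hessian f x d)
    linarith

/-! ### From deviation bounds to tolerances -/

theorem norm_batch_mean_sub_le {ι V : Type*} [NormedAddCommGroup V] [NormedSpace ℝ V]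
    (v : ι → V) (M : V) (l : List ι) (hl : 0 < l.length) {r τ : ℝ}
    (h : ‖(l.map fun i => v i - M).sum‖ ≤ r * √(l.length : ℝ)) (hr : r ≤ τ * √(l.length : ℝ)) :
    ‖(1 / (l.length : ℝ)) • (l.map v).sum - M‖ ≤ τ := by
  have hs : (0 : ℝ) < l.length := by exact_mod_cast hl
  have e : ∀ l : List ι, (l.map fun i => v i - M).sum = (l.map v).sum - (l.length : ℝ) • M := by
    intro l
    induction l with
    | nil => simp
    | cons a l ih =>
      simp only [List.map_cons, List.sum_cons, List.length_cons, ih]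
      push_cast
      rw [add_smul, one_smul]; abel
  have e2 : (1 / (l.length : ℝ)) • (l.map v).sum - M =
      (1 / (l.length : ℝ)) • (l.map fun i => v i - M).sum := by
    rw [e, smul_sub, smul_smul, one_div_mul_cancel hs.ne', one_smul]
  rw [e2, norm_smul, Real.norm_of_nonneg (by positivity), one_div, inv_mul_le_iff₀ hs]
  refine h.trans ((mul_le_mul_of_nonneg_right hr (Real.sqrt_nonneg _)).trans_eq ?_)
  rw [mul_assoc, Real.mul_self_sqrt hs.le, mul_comm]

theorem le_mul_sqrt_of_sq_le {r τ s : ℝ} (hτ : 0 ≤ τ) (hs : 0 ≤ s) (h : r ^ 2 ≤ τ ^ 2 * s) :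
    r ≤ τ * √s := by
  refine (abs_le_of_sq_le_sq' ?_ (by positivity)).2
  rwa [mul_pow, Real.sq_sqrt hs]

/-- The size bound converts a deviation of order `√|S|` into the relative tolerance pointwise, so
`δᵍ` and `g` may depend on the batch. It also forces the batch to be nonempty. -/
theorem SizesSuffice.norm_subGradient_sub_le {n m : ℕ} {F : Fin m → Vec n → ℝ} {x M : Vec n}
    {Sg : List (Fin m)} {Ug Uh δBar δg δh : ℝ} {Nh : ℕ} (hUg : 0 < Ug)
    (hS : SizesSuffice Ug Uh δBar δg δh (subGradient F Sg x) Sg.length Nh)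
    (h : ‖(Sg.map fun i => gradient (F i) x - M).sum‖ ≤
      Ug * √(Sg.length : ℝ) * (1 + √(8 * Real.log (1 / δBar)))) :
    ‖subGradient F Sg x - M‖ ≤ δg * ‖subGradient F Sg x‖ := by
  have hg : 0 < ‖subGradient F Sg x‖ := norm_pos_iff.mpr hS.grad_ne_zero
  have hδ := hS.grad_tol_pos
  have hsize := hS.grad_size
  have hpos : (0 : ℝ) < Sg.length := by
    refine lt_of_lt_of_le ?_ hsize
    positivity
  refine norm_batch_mean_sub_le (fun i => gradient (F i) x) M Sg (by exact_mod_cast hpos)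
    (r := Ug * (1 + √(8 * Real.log (1 / δBar)))) (h.trans_eq (by ring)) ?_
  refine le_mul_sqrt_of_sq_le (by positivity) hpos.le ?_
  rw [div_le_iff₀ (by positivity)] at hsize
  rw [mul_pow, mul_pow]
  linarith

theorem SizesSuffice.norm_subHessian_sub_le {n m : ℕ} {F : Fin m → Vec n → ℝ} {x g : Vec n}
    {M : Vec n →L[ℝ] Vec n} {Sh : List (Fin m)} {Ug Uh δBar δg δh : ℝ} {Ng : ℕ} (hUh : 0 < Uh)
    (hδ0 : 0 < δBar) (hδ1 : δBar < 1) (hδh : 0 < δh)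
    (hS : SizesSuffice Ug Uh δBar δg δh g Ng Sh.length)
    (h : ‖(Sh.map fun i => hessian (F i) x - M).sum‖ ≤
      4 * Uh * √(Sh.length : ℝ) * √(Real.log (2 * n / δBar))) :
    ‖subHessian F Sh x - M‖ ≤ δh := by
  have hn : 1 ≤ n := by
    rcases Nat.eq_zero_or_pos n with rfl | hn
    · exact absurd (Subsingleton.elim _ _) hS.grad_ne_zero
    · exact hn
  have hn' : (1 : ℝ) ≤ n := by exact_mod_cast hn
  have hL : 0 < Real.log (2 * n / δBar) := by
    refine Real.log_pos ?_
    rw [lt_div_iff₀ hδ0]; linarith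
  have hsize := hS.hess_size
  have hpos : (0 : ℝ) < Sh.length := by
    refine lt_of_lt_of_le ?_ hsize
    positivity
  refine norm_batch_mean_sub_le (fun i => hessian (F i) x) M Sh (by exact_mod_cast hpos)
    (r := 4 * Uh * √(Real.log (2 * n / δBar))) (h.trans_eq (by ring)) ?_
  refine le_mul_sqrt_of_sq_le hδh.le hpos.le ?_
  rw [div_mul_eq_mul_div, div_le_iff₀ (by positivity)] at hsize
  rw [mul_pow, Real.sq_sqrt hL.le]
  linarith

theorem measurable_map_sum {ι V W : Type*} [MeasurableSpace V] [MeasurableSpace W] [AddCommMonoid W]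
    [MeasurableAdd₂ W] {φ : ι → V → W} (hφ : ∀ i, Measurable (φ i)) (l : List ι) :
    Measurable fun y => (l.map fun i => φ i y).sum := by
  induction l with
  | nil => simp
  | cons a l ih =>
    simp only [List.map_cons, List.sum_cons]
    exact (hφ a).add ih

/-! ### All batches of the first iterations are good -/

theorem le_measure_all_good {Ω : Type*} {mΩ : MeasurableSpace Ω} {P : Measure Ω}
    [IsProbabilityMeasure P] {ℱ : Filtration ℕ mΩ} {c : Sampling} {m : ℕ}
    {Sg Sh : ℕ → Ω → List (Fin m)}
    (hSg_meas : ∀ k l, MeasurableSet[ℱ (2 * k + 1)] {ω | Sg k ω = l})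
    (hSh_meas : ∀ k l, MeasurableSet[ℱ (2 * k + 2)] {ω | Sh k ω = l})
    (hSg : ∀ k, IsUniformBatch P c (ℱ (2 * k)) (Sg k))
    (hSh : ∀ k, IsUniformBatch P c (ℱ (2 * k + 1)) (Sh k))
    {Bg Bh : ℕ → List (Fin m) → Set Ω} (hBg : ∀ k l, MeasurableSet[ℱ (2 * k)] (Bg k l))
    (hBh : ∀ k l, MeasurableSet[ℱ (2 * k)] (Bh k l)) {pg ph δ : ℝ} (hpg : 0 ≤ pg)
    (hpg1 : pg ≤ 1) (hph : 0 ≤ ph) (hδ1 : δ < 1) (hp : 1 - δ ≤ (1 - ph) * (1 - pg))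
    (hcg : ∀ (k : ℕ) (ω : Ω) (s : ℕ), (open Classical in
      (Finset.univ.filter fun f : Fin s → Fin m =>
        c.Admissible (List.ofFn f) ∧ ω ∈ Bg k (List.ofFn f)).card : ℝ) ≤ pg * c.count m s)
    (hch : ∀ (k : ℕ) (ω : Ω) (s : ℕ), (open Classical in
      (Finset.univ.filter fun f : Fin s → Fin m =>
        c.Admissible (List.ofFn f) ∧ ω ∈ Bh k (List.ofFn f)).card : ℝ) ≤ ph * c.count m s)
    (k : ℕ) :
    MeasurableSet[ℱ (2 * k)] {ω | ∀ j < k, ω ∉ Bg j (Sg j ω) ∧ ω ∉ Bh j (Sh j ω)} ∧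
    ENNReal.ofReal ((1 - δ) ^ k) ≤
      P {ω | ∀ j < k, ω ∉ Bg j (Sg j ω) ∧ ω ∉ Bh j (Sh j ω)} := by
  induction k with
  | zero => simp
  | succ k ih =>
    obtain ⟨hm, hle⟩ := ih
    set A := {ω | ∀ j < k, ω ∉ Bg j (Sg j ω) ∧ ω ∉ Bh j (Sh j ω)} with hA
    have hsplit : {ω | ∀ j < k + 1, ω ∉ Bg j (Sg j ω) ∧ ω ∉ Bh j (Sh j ω)} =
        (A ∩ {ω | ω ∉ Bg k (Sg k ω)}) ∩ {ω | ω ∉ Bh k (Sh k ω)} := by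
      ext ω
      simp only [hA, Nat.lt_succ_iff_lt_or_eq, or_imp, forall_and, forall_eq, Set.mem_inter_iff,
        Set.mem_ofPred_eq]
      tauto
    have h01 : ℱ (2 * k) ≤ ℱ (2 * k + 1) := ℱ.mono (by omega)
    have h12 : ℱ (2 * k + 1) ≤ ℱ (2 * k + 2) := ℱ.mono (by omega)
    have hA1 : MeasurableSet[ℱ (2 * k + 1)] (A ∩ {ω | ω ∉ Bg k (Sg k ω)}) :=
      (h01 _ hm).inter
        (measurableSet_mem_batch (hSg_meas k) _ fun l => h01 _ (hBg k l)).compl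
    have hA2 : MeasurableSet[ℱ (2 * k + 2)]
        ((A ∩ {ω | ω ∉ Bg k (Sg k ω)}) ∩ {ω | ω ∉ Bh k (Sh k ω)}) :=
      (h12 _ hA1).inter
        (measurableSet_mem_batch (hSh_meas k) _ fun l => h12 _ (h01 _ (hBh k l))).compl
    rw [hsplit]
    refine ⟨hA2, ?_⟩
    have hg := le_measure_inter_good_batch (ℱ.le _) (hSg k) (Bg k) (hBg k) hpg (hcg k) hm
    have hh := le_measure_inter_good_batch (ℱ.le _) (hSh k) (Bh k)
      (fun l => h01 _ (hBh k l)) hph (hch k) hA1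
    -- Were `1 - ph` negative, the product in `hp` would be nonpositive, contradicting `δ < 1`.
    have hph1 : 0 ≤ 1 - ph := by
      by_contra hneg
      have : (1 - ph) * (1 - pg) ≤ 0 :=
        mul_nonpos_of_nonpos_of_nonneg (by linarith) (by linarith)
      linarith
    calc ENNReal.ofReal ((1 - δ) ^ (k + 1))
        ≤ ENNReal.ofReal ((1 - ph) * (1 - pg) * (1 - δ) ^ k) := by
          refine ENNReal.ofReal_le_ofReal ?_
          rw [pow_succ, mul_comm]
          exact mul_le_mul_of_nonneg_right hp (pow_nonneg (by linarith) k)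
      _ = ENNReal.ofReal (1 - ph) * (ENNReal.ofReal (1 - pg) * ENNReal.ofReal ((1 - δ) ^ k)) := by
          rw [ENNReal.ofReal_mul (mul_nonneg hph1 (by linarith)), ENNReal.ofReal_mul hph1, mul_assoc]
      _ ≤ ENNReal.ofReal (1 - ph) * P (A ∩ {ω | ω ∉ Bg k (Sg k ω)}) := by
          gcongr
          refine le_trans ?_ hg
          gcongr
      _ ≤ _ := hh

end OEFNewton

/-! ### The convergence estimate along a run -/

theorem mainTheorem12 {n m : ℕ} (hm : 0 < m)
    -- the objective `f = (1/m) ∑ fᵢ` with effective domain `D`, strongly convex with minimizer `xs`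
    (F : Fin m → OEFNewton.Vec n → ℝ) (D : Set (OEFNewton.Vec n)) (σ : ℝ) (hσ : 0 < σ)
    (hconv : StrongConvexOn D σ (OEFNewton.finiteSum F))
    (xs : OEFNewton.Vec n) (hmin : IsMinOn (OEFNewton.finiteSum F) D xs)
    -- smoothness near the minimizer
    (ε0 : ℝ) (hε0 : 0 < ε0) (hball : Metric.ball xs ε0 ⊆ D)
    (hF : ∀ i, DifferentiableOn ℝ (F i) (Metric.ball xs ε0))
    (hF' : ∀ i, DifferentiableOn ℝ (gradient (F i)) (Metric.ball xs ε0))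
    (hC2 : ContDiffOn ℝ 2 (OEFNewton.finiteSum F) (Metric.ball xs ε0))
    (Lg Lh : NNReal)
    (hLg : LipschitzOnWith Lg (gradient (OEFNewton.finiteSum F)) (Metric.ball xs ε0))
    (hLh : LipschitzOnWith Lh (OEFNewton.hessian (OEFNewton.finiteSum F)) (Metric.ball xs ε0))
    -- bounds on the gradient of `f`, and on the gradients and Hessians of the components
    (Ug : ℝ) (hUg : 0 < Ug)
    (hfg : ∀ y ∈ Metric.ball xs ε0, ‖gradient (OEFNewton.finiteSum F) y‖ ≤ Ug)
    (UgHat UhHat : ℝ) (hUgHat : 0 < UgHat) (hUhHat : 0 < UhHat)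
    (hFg : ∀ i, ∀ y ∈ Metric.ball xs ε0, ‖gradient (F i) y‖ ≤ UgHat)
    (hFh : ∀ i, ∀ y ∈ Metric.ball xs ε0, ‖OEFNewton.hessian (F i) y‖ ≤ UhHat)
    -- parameters
    (θ : ℝ) (hθ0 : 0 < θ) (hθ1 : θ ≤ 1)
    (δgBar δhBar δBar : ℝ) (hδgBar0 : 0 ≤ δgBar) (hδgBar1 : δgBar < 1)
    (hδhBar0 : 0 < δhBar) (hδhBar1 : δhBar < σ) (hδBar0 : 0 < δBar) (hδBar1 : δBar < 1)
    (ε3 : ℝ) (hε3 : 0 < ε3)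
    (hε3' : ε3 ≤ OEFNewton.eps2 σ Lg Lh Ug ε0 θ δgBar δhBar /
      (1 + 2 * OEFNewton.varsigma0 σ Lg Lh ε0 δhBar))
    -- randomness: `ℱ (2k)` is the information before iteration `k`, and `ℱ (2k+1)` the information
    -- after its gradient batch has been drawn and before its Hessian batch is drawn
    {Ω : Type*} [mΩ : MeasurableSpace Ω] (P : MeasureTheory.Measure Ω)
    [MeasureTheory.IsProbabilityMeasure P] (ℱ : MeasureTheory.Filtration ℕ mΩ)
    (c : OEFNewton.Sampling) (Sg Sh : ℕ → Ω → List (Fin m))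
    (hSg_meas : ∀ k l, MeasurableSet[ℱ (2 * k + 1)] {ω | Sg k ω = l})
    (hSh_meas : ∀ k l, MeasurableSet[ℱ (2 * k + 2)] {ω | Sh k ω = l})
    (hSg : ∀ k, OEFNewton.IsUniformBatch P c (ℱ (2 * k)) (Sg k))
    (hSh : ∀ k, OEFNewton.IsUniformBatch P c (ℱ (2 * k + 1)) (Sh k))
    -- the run of the method; nothing is required of iteration `k` when `g_k = 0`
    (x : ℕ → Ω → OEFNewton.Vec n) (δg δh : ℕ → Ω → ℝ)
    (hx_meas : ∀ k, Measurable[ℱ (2 * k)] (x k))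
    (hδg_meas : ∀ k, Measurable (δg k)) (hδh_meas : ∀ k, Measurable (δh k))
    (hx0 : ∀ ω, x 0 ω ∈ Metric.ball xs ε3)
    (hstep : ∀ k ω, OEFNewton.subGradient F (Sg k ω) (x k ω) ≠ 0 →
      OEFNewton.IsNewtonStep σ Lg θ δgBar δhBar (δg k ω) (δh k ω)
        (OEFNewton.subGradient F (Sg k ω) (x k ω)) (x (k + 1) ω - x k ω)
        (OEFNewton.subHessian F (Sh k ω) (x k ω)))
    (k : ℕ) :
    ENNReal.ofReal ((1 - δBar) ^ k) ≤
      P {ω | (∀ j < k, OEFNewton.SizesSuffice UgHat UhHat δBar (δg j ω) (δh j ω)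
            (OEFNewton.subGradient F (Sg j ω) (x j ω)) (Sg j ω).length (Sh j ω).length) →
          ∀ j < k, ‖x (j + 1) ω - xs‖ ≤
            OEFNewton.varsigma2 σ Lg Lh Ug ε0 θ δgBar δhBar * ‖x j ω - xs‖ ^ (1 + θ)} := by
  set f := OEFNewton.finiteSum F with hf
  set O := Metric.ball xs ε0 with hOdef
  have hO : IsOpen O := Metric.isOpen_ball
  have hfd : DifferentiableOn ℝ f O := hC2.differentiableOn (by norm_num)
  have hfd' : DifferentiableOn ℝ (gradient f) O := fun y hy =>
    (OEFNewton.hasFDerivAt_gradient_finiteSum hO hF hF' hy).differentiableAt.differentiableWithinAt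
  -- For a fixed list the event depends only on `x j`, hence on the past. Intersecting with `O`
  -- makes it empty where the component bounds are unavailable.
  let Bg : ℕ → List (Fin m) → Set Ω := fun j l => x j ⁻¹' (O ∩ {y |
    UgHat * √(l.length : ℝ) * (1 + √(8 * Real.log (1 / δBar))) <
      ‖(l.map fun i => gradient (F i) y - gradient f y).sum‖})
  let Bh : ℕ → List (Fin m) → Set Ω := fun j l => x j ⁻¹' (O ∩ {y |
    4 * UhHat * √(l.length : ℝ) * √(Real.log (2 * n / δBar)) <
      ‖(l.map fun i => OEFNewton.hessian (F i) y - OEFNewton.hessian f y).sum‖})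
  have hBg : ∀ j l, MeasurableSet[ℱ (2 * j)] (Bg j l) := fun j l =>
    hx_meas j (hO.measurableSet.inter (measurableSet_lt measurable_const
      (OEFNewton.measurable_map_sum (fun i => (OEFNewton.measurable_gradient (F i)).sub
        (OEFNewton.measurable_gradient f)) l).norm))
  have hBh : ∀ j l, MeasurableSet[ℱ (2 * j)] (Bh j l) := fun j l =>
    hx_meas j (hO.measurableSet.inter (measurableSet_lt measurable_const
      (OEFNewton.measurable_map_sum (fun i => (OEFNewton.measurable_hessian (F i)).sub
        (OEFNewton.measurable_hessian f)) l).norm))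
  have hmemg : ∀ j l ω, ω ∈ Bg j l ↔ x j ω ∈ O ∧
      UgHat * √(l.length : ℝ) * (1 + √(8 * Real.log (1 / δBar))) <
        ‖(l.map fun i => gradient (F i) (x j ω) - gradient f (x j ω)).sum‖ :=
    fun _ _ _ => Iff.rfl
  have hmemh : ∀ j l ω, ω ∈ Bh j l ↔ x j ω ∈ O ∧
      4 * UhHat * √(l.length : ℝ) * √(Real.log (2 * n / δBar)) <
        ‖(l.map fun i => OEFNewton.hessian (F i) (x j ω) - OEFNewton.hessian f (x j ω)).sum‖ :=
    fun _ _ _ => Iff.rfl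
  have hgood := (OEFNewton.le_measure_all_good (P := P) hSg_meas hSh_meas hSg hSh hBg hBh
    (OEFNewton.gradFail_nonneg hδBar0) (OEFNewton.gradFail_le_one hδBar0 hδBar1)
    (by positivity : 0 ≤ δBar ^ 2 / 2) hδBar1 (OEFNewton.one_sub_le_mul hδBar0 hδBar1)
    (fun j ω s => by
      by_cases hω : x j ω ∈ O
      · have h := OEFNewton.card_gradient_batch_le c hm _
          (OEFNewton.sum_gradient_eq hm hO hF hω) hUgHat (fun i => hFg i _ hω) hδBar0 hδBar1 s
        refine le_trans (le_of_eq ?_) h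
        congr 2
        ext l
        simp only [Finset.mem_filter, Finset.mem_univ, hmemg, hω, true_and, List.map_ofFn,
          List.sum_ofFn, List.length_ofFn, Function.comp_apply, hf]
      · have := OEFNewton.gradFail_nonneg hδBar0
        simp only [hmemg, hω, false_and, and_false, Finset.filter_false, Finset.card_empty,
          Nat.cast_zero]
        positivity)
    (fun j ω s => by
      by_cases hω : x j ω ∈ O
      · have h := OEFNewton.card_hessian_batch_le c hm _
          (fun i => OEFNewton.hessian_isSymmetric hO (hF i) (hF' i) hω)
          (OEFNewton.sum_hessian_eq hm hO hF hF' hω) hUhHat (fun i => hFh i _ hω) hδBar0 hδBar1 s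
        refine le_trans (le_of_eq ?_) h
        congr 2
        ext l
        simp only [Finset.mem_filter, Finset.mem_univ, hmemh, hω, true_and, List.map_ofFn,
          List.sum_ofFn, List.length_ofFn, Function.comp_apply, hf]
      · simp only [hmemh, hω, false_and, and_false, Finset.filter_false, Finset.card_empty,
          Nat.cast_zero]
        positivity) k).2
  -- The rest is deterministic: every outcome without a bad batch satisfies the implication.
  -- Measurability of the target event is not needed.
  refine hgood.trans (measure_mono fun ω hω => ?_)
  intro hsizes
  have hς0 := OEFNewton.varsigma0_nonneg Lg.coe_nonneg Lh.coe_nonneg hε0 hδhBar1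
  have hε23 : ε3 * (1 + 2 * OEFNewton.varsigma0 σ Lg Lh ε0 δhBar) ≤
      OEFNewton.eps2 σ Lg Lh Ug ε0 θ δgBar δhBar := by
    rwa [le_div_iff₀ (by positivity)] at hε3'
  have hε12 : OEFNewton.eps2 σ Lg Lh Ug ε0 θ δgBar δhBar * (1 + OEFNewton.varsigma0 σ Lg Lh ε0 δhBar)
      ≤ ε0 := by
    have h1 : OEFNewton.eps2 σ Lg Lh Ug ε0 θ δgBar δhBar ≤
        ε0 / (1 + OEFNewton.varsigma0 σ Lg Lh ε0 δhBar) := min_le_left _ _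
    rwa [le_div_iff₀ (by positivity)] at h1
  have hε3le : ε3 ≤ OEFNewton.eps2 σ Lg Lh Ug ε0 θ δgBar δhBar := by nlinarith
  have hstepj : ∀ j < k, ‖x j ω - xs‖ < ε3 → ‖x (j + 1) ω - xs‖ ≤
      OEFNewton.varsigma2 σ Lg Lh Ug ε0 θ δgBar δhBar * ‖x j ω - xs‖ ^ (1 + θ) := by
    intro j hj hxj
    have hS := hsizes j hj
    obtain ⟨hbg, hbh⟩ := hω j hj
    have hN := hstep j ω hS.grad_ne_zero
    have hx0' : ‖x j ω - xs‖ * (1 + OEFNewton.varsigma0 σ Lg Lh ε0 δhBar) < ε0 := by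
      refine lt_of_lt_of_le ?_ hε12
      gcongr
      linarith
    have hxO : x j ω ∈ O := by
      rw [hOdef, mem_ball_iff_norm]
      refine lt_of_le_of_lt (le_mul_of_one_le_right (norm_nonneg _) ?_) hx0'
      linarith
    have hbg' := not_lt.mp fun h => hbg ((hmemg j _ ω).mpr ⟨hxO, h⟩)
    have hbh' := not_lt.mp fun h => hbh ((hmemh j _ ω).mpr ⟨hxO, h⟩)
    have h := OEFNewton.newton_step_le hσ hconv hmin hε0 hball hfd hfd' hLg hLh hUg hfg hθ0 hθ1
      hδgBar0 hδgBar1 hδhBar1 hS.grad_ne_zero hN hx0'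
      (hS.norm_subGradient_sub_le hUgHat hbg')
      (hS.norm_subHessian_sub_le hUhHat hδBar0 hδBar1 hN.hess_tol_pos hbh')
    rwa [add_sub_cancel] at h
  -- Halving keeps the iterates within `ε3`, hence in `O`, so the intersection with `O` in the bad
  -- events loses nothing.
  have hnear : ∀ j ≤ k, ‖x j ω - xs‖ < ε3 := by
    intro j
    induction j with
    | zero => exact fun _ => mem_ball_iff_norm.mp (hx0 ω)
    | succ j ih =>
      intro hj
      have h1 := ih (by omega)
      have h2 := hstepj j (by omega) h1
      have h3 := OEFNewton.varsigma2_mul_rpow_le hσ Lg.coe_nonneg Lh.coe_nonneg hUg hε0 hθ0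
        hδgBar0 hδgBar1 hδhBar1 (norm_nonneg _) (h1.le.trans hε3le)
      linarith [norm_nonneg (x j ω - xs)]
  exact fun j hj => hstepj j hj (hnear j hj.le)
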